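/- Fix an integer $n\ge 2$. **Columns.** A *PBW-semistandard column* is a sequence $(\alpha_1,\dots,\alpha_k)$ with $1\le k\le n-1$ and all $\alpha_r\in\{1,\dots,n\}$, such that $\alpha_r\le k$ implies $\alpha_r=r$, and such that $\alpha_r>\alpha_s$ whenever $r<s$ and $\alpha_r,\alpha_s>k$. Let $\mathcal N$ be the set of all these columns, ordered by: $(\beta_1,\dots,\beta_l)\le(\alpha_1,\dots,\alpha_k)$ if and only if $l\le k$ and for every $r\le l$ there is an $s$ with $r\le s\le k$ and $\alpha_s\ge\beta_r$. This is a finite distributive lattice; write $\land,\lor$ for its meet and join. **The Plücker ideal.** Let $R$ be the polynomial ring over $\mathbb C$ in the Plücker variables $X_{i_1,\dots,i_k}$, $1\le k\le n-1$, $1\le i_1<\dots<i_k\le n$. Put $X_{i_{\sigma(1)},\dots,i_{\sigma(k)}}=(-1)^\sigma X_{i_1,\dots,i_k}$ for $\sigma\in S_k$, and $X_a=X_{\alpha_1,\dots,\alpha_k}$ for $a=(\alpha_1,\dots,\alpha_k)\in\mathcal N$; then $R=\mathbb C[X_a : a\in\mathcal N]$. Let $I\subset R$ be the ideal of Plücker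 relations of the variety of complete flags in $\mathbb C^n$, that is, the kernel of the homomorphism $R\to\mathbb C[z_{i,j} : 1\le i,j\le n]$ that maps $X_{i_1,\dots,i_k}$ to $\det(z_{p,i_q})_{1\le p,q\le k}$. **Straightening relations.** A monomial in the $X_a$ is *standard* if its factors are indexed by pairwise comparable elements of $\mathcal N$. For incomparable $a,b\in\mathcal N$ let $e(a,b)$ be the element of $I$ of the form $X_aX_b+Q$, where $Q$ is a linear combination of standard monomials. **The operation $\odot$.** Let $\mathcal P$ be the set of join-irreducible elements of $\mathcal N$, let $V_o\subset\mathcal P$ consist of the columns $(1,2,\dots,k)$ with $2\le k\le n-1$, and let $V_c=\mathcal P\setminus V_o$. For $a\in\mathcal N$ let $\iota(a)=\{p\in\mathcal P : p\le a\}$. For an order ideal $J\subset\mathcal P$ let $K(J)$ consist of all elements of $J\cap V_o$ and of those elements of $J\cap V_c$ that are maximal in $J$. Then $a\odot b$ is the unique element of $\mathcal N$ such that, for indicator functions, $$\mathbf 1_{K(\iota(a))}+\mathbf 1_{K(\iota(b))}=\mathbf 1_{K(\iota(a)\cup\iota(b))}+\mathbf 1_{K(\iota(a\odot b))}.$$ **Theorem.**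 For all incomparable $a,b\in\mathcal N$ the relation $e(a,b)$ exists and is unique. Moreover: (a) The relations $e(a,b)$, over all incomparable pairs $\{a,b\}\subset\mathcal N$, form a minimal generating set of $I$: they generate $I$, and no proper subset of them does. (b), (c) For all incomparable $a,b\in\mathcal N$ one can write $$e(a,b)=X_aX_b-\sum_{i=0}^{m}c_i\,X_{g_i}X_{h_i}$$ with $m\ge 0$, pairwise distinct pairs $(g_i,h_i)\in\mathcal N^2$ with $g_i<h_i$, and nonzero $c_i\in\mathbb C$, such that $g_0=a\odot b$, $h_0=a\lor b$, $c_0=1$, and $g_i\le a\land b$, $h_i>a\lor b$ for all $1\le i\le m$. In particular, $R/I$ is an algebra with straightening laws on $\mathcal N$ with respect to the map $\varepsilon'$ that sends $a$ to the class of $X_a$: the map $\varepsilon'$ is injective; the products $\varepsilon'(\omega_1)\cdots\varepsilon'(\omega_m)$ with $m\ge 0$ and $\omega_1\le\dots\le\omega_m$ in $\mathcal N$ form a $\mathbb C$-basis of $R/I$; and for incomparable $\chi_1,\chi_2\in\mathcal N$, every product $\varepsilon'(\omega_1)\cdots\varepsilon'(\omega_m)$ with $\omega_1\le\dots\le\omega_m$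 that occurs in the expansion of $\varepsilon'(\chi_1)\varepsilon'(\chi_2)$ in this basis has $m\ge 1$, $\omega_1\le\chi_1$ and $\omega_1\le\chi_2$. -/

import Mathlib

/-! ### PBW-semistandard columns and their lattice -/

/-- A one-column PBW-semistandard tableau `(α₁, …, α_k)` with `1 ≤ k ≤ n - 1` on the alphabet
`{1, …, n}`. Positions and letters are both numbered from `0`: `entry r` is `α_{r+1} - 1`. -/
@[ext]
structure PBWColumn (n : ℕ) where
  /-- the height `k` of the column -/
  len : ℕ
  len_pos : 1 ≤ len
  len_lt : len < n
  /-- the entries, from top to bottom -/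
  entry : Fin len → Fin n
  /-- `α_r ≤ k` implies `α_r = r` -/
  fixed : ∀ r, (entry r : ℕ) < len → (entry r : ℕ) = r
  /-- the entries exceeding `k` decrease -/
  decr : ∀ r s, r < s → len ≤ (entry r : ℕ) → len ≤ (entry s : ℕ) → entry s < entry r

namespace PBWColumn

variable {n : ℕ}

/-- `b ≤ a` if the two-column tableau with columns `a`, `b` (in this order) is PBW-semistandard:
`b` is not longer than `a`, and for every entry `β_r` of `b` there is `s ≥ r` with `α_s ≥ β_r`. -/
instance : LE (PBWColumn n) where
  le b a := b.len ≤ a.len ∧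
    ∀ r : Fin b.len, ∃ s : Fin a.len, (r : ℕ) ≤ (s : ℕ) ∧ b.entry r ≤ a.entry s

theorem le_def {a b : PBWColumn n} : b ≤ a ↔ b.len ≤ a.len ∧
    ∀ r : Fin b.len, ∃ s : Fin a.len, (r : ℕ) ≤ (s : ℕ) ∧ b.entry r ≤ a.entry s := Iff.rfl

/-- Auxiliary, for the lattice structure: the largest letter at or below a position
(letters numbered from `1`, and `0` past the end of the column). -/
def prof (a : PBWColumn n) (r : ℕ) : ℕ :=
  (Finset.univ.filter fun s : Fin a.len => r ≤ (s : ℕ)).sup fun s => (a.entry s : ℕ) + 1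

theorem le_prof (a : PBWColumn n) {r : ℕ} (s : Fin a.len) (h : r ≤ s) :
    (a.entry s : ℕ) + 1 ≤ a.prof r :=
  Finset.le_sup (f := fun s => (a.entry s : ℕ) + 1) (by simpa using h)

theorem prof_le_iff (a : PBWColumn n) {r m : ℕ} :
    a.prof r ≤ m ↔ ∀ s : Fin a.len, r ≤ s → (a.entry s : ℕ) + 1 ≤ m := by
  simp [prof, Finset.sup_le_iff]

theorem lt_prof_iff (a : PBWColumn n) {r m : ℕ} :
    m < a.prof r ↔ ∃ s : Fin a.len, r ≤ s ∧ m < (a.entry s : ℕ) + 1 := by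
  simp [prof, Finset.lt_sup_iff]

theorem prof_eq_zero (a : PBWColumn n) {r : ℕ} (h : a.len ≤ r) : a.prof r = 0 := by
  refine Nat.le_zero.1 ((a.prof_le_iff).2 fun s hs => ?_)
  have := s.2
  omega

theorem prof_antitone (a : PBWColumn n) : Antitone a.prof := fun _ _ h =>
  (a.prof_le_iff).2 fun s hs => a.le_prof s (h.trans hs)

theorem prof_le (a : PBWColumn n) (r : ℕ) : a.prof r ≤ n :=
  (a.prof_le_iff).2 fun s _ => (a.entry s).2

theorem le_entry (a : PBWColumn n) (r : Fin a.len) : (r : ℕ) ≤ a.entry r := by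
  by_cases h : (a.entry r : ℕ) < a.len
  · exact (a.fixed r h).ge
  · have := r.2
    omega

theorem len_le_prof (a : PBWColumn n) {r : ℕ} (h : r < a.len) : a.len ≤ a.prof r := by
  have h1 := a.le_entry ⟨a.len - 1, by omega⟩
  have h2 := a.le_prof (r := r) ⟨a.len - 1, by omega⟩ (by simp; omega)
  simp only at h1
  omega

theorem prof_succ (a : PBWColumn n) (r : Fin a.len) :
    a.prof r = max ((a.entry r : ℕ) + 1) (a.prof (r + 1)) := by
  apply le_antisymm
  · refine (a.prof_le_iff).2 fun s hs => ?_
    rcases eq_or_lt_of_le hs with h | h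
    · rw [← Fin.ext h]
      exact le_max_left _ _
    · exact (a.le_prof s h).trans (le_max_right _ _)
  · exact max_le (a.le_prof r le_rfl) (a.prof_antitone (Nat.le_succ _))

theorem entry_eq (a : PBWColumn n) (r : Fin a.len) :
    (a.entry r : ℕ) = if a.prof (r + 1) < a.prof r then a.prof r - 1 else (r : ℕ) := by
  have h := a.prof_succ r
  split_ifs with hlt
  · have : a.prof r = (a.entry r : ℕ) + 1 := by
      rcases max_choice ((a.entry r : ℕ) + 1) (a.prof (r + 1)) with h' | h' <;> omega
    omega
  · have h1 : (a.entry r : ℕ) < a.prof (r + 1) := by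
      have := a.le_prof r le_rfl
      omega
    obtain ⟨s, hs, hs'⟩ := (a.lt_prof_iff).1 h1
    by_contra hne
    have hr : a.len ≤ (a.entry r : ℕ) := by
      by_contra hr
      exact hne (a.fixed r (by omega))
    have := a.decr r s (Fin.lt_def.2 (by omega)) hr (by omega)
    rw [Fin.lt_def] at this
    omega

theorem le_iff_prof {a b : PBWColumn n} : b ≤ a ↔ ∀ r, b.prof r ≤ a.prof r := by
  rw [le_def]
  constructor
  · rintro ⟨-, h⟩ r
    refine (b.prof_le_iff).2 fun s hs => ?_
    obtain ⟨t, ht, ht'⟩ := h s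
    have := a.le_prof (r := r) t (hs.trans ht)
    rw [Fin.le_def] at ht'
    omega
  · intro h
    refine ⟨?_, fun r => ?_⟩
    · by_contra hl
      have h1 := h a.len
      have h2 := b.len_le_prof (r := a.len) (by omega)
      rw [a.prof_eq_zero le_rfl] at h1
      omega
    · have h1 : (b.entry r : ℕ) < a.prof r := (b.le_prof r le_rfl).trans (h r)
      obtain ⟨s, hs, hs'⟩ := (a.lt_prof_iff).1 h1
      exact ⟨s, hs, by rw [Fin.le_def]; omega⟩

theorem prof_injective : Function.Injective (prof (n := n)) := by
  intro a b h
  have hl : a.len = b.len := by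
    by_contra hne
    rcases lt_or_gt_of_ne hne with hlt | hlt
    · have h1 := b.len_le_prof hlt
      rw [← h, a.prof_eq_zero le_rfl] at h1
      omega
    · have h1 := a.len_le_prof hlt
      rw [h, b.prof_eq_zero le_rfl] at h1
      omega
  have he : ∀ (r : ℕ) (ha : r < a.len) (hb : r < b.len), a.entry ⟨r, ha⟩ = b.entry ⟨r, hb⟩ := by
    intro r ha hb
    have h1 := a.entry_eq ⟨r, ha⟩
    have h2 := b.entry_eq ⟨r, hb⟩
    rw [h] at h1
    exact Fin.ext (h1.trans h2.symm)
  rcases a with ⟨k, _, _, f, _, _⟩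
  rcases b with ⟨l, _, _, g, _, _⟩
  obtain rfl : k = l := hl
  obtain rfl : f = g := funext fun r => he r r.2 r.2
  rfl

/-- The functions that occur as `prof`. -/
def IsProf (n : ℕ) (f : ℕ → ℕ) : Prop :=
  ∃ k, 1 ≤ k ∧ k < n ∧ Antitone f ∧ (∀ r, f r ≤ n) ∧ (∀ r < k, k ≤ f r) ∧ ∀ r, k ≤ r → f r = 0

theorem isProf_prof (a : PBWColumn n) : IsProf n a.prof :=
  ⟨a.len, a.len_pos, a.len_lt, a.prof_antitone, a.prof_le, fun _ => a.len_le_prof,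
    fun _ => a.prof_eq_zero⟩

theorem exists_prof_eq {f : ℕ → ℕ} (hf : IsProf n f) : ∃ a : PBWColumn n, a.prof = f := by
  obtain ⟨k, hk, hkn, hanti, hn, hlow, hzero⟩ := hf
  let a : PBWColumn n :=
    { len := k
      len_pos := hk
      len_lt := hkn
      entry := fun r => if f (r + 1) < f r then ⟨f r - 1, by have := hn r; omega⟩
        else ⟨r, r.2.trans hkn⟩
      fixed := by
        intro r h
        have h1 := hlow r r.2
        split_ifs at h ⊢ with hlt
        · simp only at h ⊢
          by_contra hne
          have h2 := hlow (r + 1) (by have := r.2; omega)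
          omega
        · rfl
      decr := by
        intro r s hrs h1 h2
        have := r.2
        have := s.2
        have h3 := hanti (show (r : ℕ) + 1 ≤ s from hrs)
        split_ifs at h1 h2 ⊢ with hr hs
        · rw [Fin.lt_def]
          simp only at h1 h2 ⊢
          omega
        all_goals simp only at h1 h2; omega }
  have hval : ∀ r : Fin k, (a.entry r : ℕ) = if f (r + 1) < f r then f r - 1 else (r : ℕ) := by
    intro r
    simp only [a]
    split_ifs <;> rfl
  refine ⟨a, funext fun r => ?_⟩
  have key : ∀ d r, k ≤ r + d → a.prof r = f r := by
    intro d
    induction d with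
    | zero => exact fun r hr => (a.prof_eq_zero hr).trans (hzero r hr).symm
    | succ d ih =>
      intro r hr
      by_cases hrk : r < k
      · have h1 := a.prof_succ ⟨r, hrk⟩
        have h2 := hval ⟨r, hrk⟩
        have h3 := hlow r hrk
        have h4 := hanti (Nat.le_succ r)
        simp only at h1 h2
        rw [ih (r + 1) (by omega)] at h1
        rw [h1, h2]
        simp only [Nat.succ_eq_add_one] at h4
        split_ifs with hlt
        · rw [max_eq_left] <;> omega
        · rw [max_eq_right] <;> omega
      · exact (a.prof_eq_zero (not_lt.1 hrk)).trans (hzero r (not_lt.1 hrk)).symm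
  exact key k r (Nat.le_add_left _ _)

theorem IsProf.sup {f g : ℕ → ℕ} (hf : IsProf n f) (hg : IsProf n g) :
    IsProf n fun r => max (f r) (g r) := by
  obtain ⟨k, hk, hkn, hanti, hn, hlow, hzero⟩ := hf
  obtain ⟨k', hk', hkn', hanti', hn', hlow', hzero'⟩ := hg
  refine ⟨max k k', by omega, by omega, fun r s h => max_le_max (hanti h) (hanti' h),
    fun r => max_le (hn r) (hn' r), fun r hr => ?_, fun r hr => ?_⟩
  · have h1 := hlow r
    have h2 := hlow' r
    rcases le_total k k' with h | h
    · exact (max_eq_right h).le.trans ((h2 (by omega)).trans (le_max_right _ _))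
    · exact (max_eq_left h).le.trans ((h1 (by omega)).trans (le_max_left _ _))
  · simp only [hzero r (by omega), hzero' r (by omega), max_self]

theorem IsProf.inf {f g : ℕ → ℕ} (hf : IsProf n f) (hg : IsProf n g) :
    IsProf n fun r => min (f r) (g r) := by
  obtain ⟨k, hk, hkn, hanti, hn, hlow, hzero⟩ := hf
  obtain ⟨k', hk', hkn', hanti', hn', hlow', hzero'⟩ := hg
  refine ⟨min k k', by omega, by omega, fun r s h => min_le_min (hanti h) (hanti' h),
    fun r => (min_le_left _ _).trans (hn r), fun r hr => ?_, fun r hr => ?_⟩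
  · exact min_le_min (hlow r (by omega)) (hlow' r (by omega))
  · rcases le_total k k' with h | h
    · simp only [hzero r (by omega), Nat.zero_min]
    · simp only [hzero' r (by omega), Nat.min_zero]

noncomputable instance : Max (PBWColumn n) where
  max a b := (exists_prof_eq (a.isProf_prof.sup b.isProf_prof)).choose

noncomputable instance : Min (PBWColumn n) where
  min a b := (exists_prof_eq (a.isProf_prof.inf b.isProf_prof)).choose

theorem prof_sup (a b : PBWColumn n) (r : ℕ) : (a ⊔ b).prof r = max (a.prof r) (b.prof r) :=
  congrFun (exists_prof_eq (a.isProf_prof.sup b.isProf_prof)).choose_spec r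

theorem prof_inf (a b : PBWColumn n) (r : ℕ) : (a ⊓ b).prof r = min (a.prof r) (b.prof r) :=
  congrFun (exists_prof_eq (a.isProf_prof.inf b.isProf_prof)).choose_spec r

/-- The PBW-semistandard columns form a distributive lattice under the order `≤` above. -/
noncomputable instance : DistribLattice (PBWColumn n) where
  le := (· ≤ ·)
  le_refl a := le_iff_prof.2 fun _ => le_rfl
  le_trans a b c h h' := le_iff_prof.2 fun r => (le_iff_prof.1 h r).trans (le_iff_prof.1 h' r)
  le_antisymm a b h h' :=
    prof_injective (funext fun r => le_antisymm (le_iff_prof.1 h r) (le_iff_prof.1 h' r))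
  sup := max
  inf := min
  le_sup_left a b := le_iff_prof.2 fun r => by rw [prof_sup]; exact le_max_left _ _
  le_sup_right a b := le_iff_prof.2 fun r => by rw [prof_sup]; exact le_max_right _ _
  sup_le a b c h h' := le_iff_prof.2 fun r => by
    rw [prof_sup]; exact max_le (le_iff_prof.1 h r) (le_iff_prof.1 h' r)
  inf_le_left a b := le_iff_prof.2 fun r => by rw [prof_inf]; exact min_le_left _ _
  inf_le_right a b := le_iff_prof.2 fun r => by rw [prof_inf]; exact min_le_right _ _
  le_inf a b c h h' := le_iff_prof.2 fun r => by
    rw [prof_inf]; exact le_min (le_iff_prof.1 h r) (le_iff_prof.1 h' r)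
  le_sup_inf a b c := le_iff_prof.2 fun r => by
    simp only [prof_sup, prof_inf]; exact (max_min_distrib_left _ _ _).ge

instance : Finite (PBWColumn n) := by
  refine Finite.of_injective
    (fun a => (⟨⟨a.len, a.len_lt⟩, a.entry⟩ : Σ k : Fin n, Fin k → Fin n)) ?_
  rintro ⟨k, _, _, f, _, _⟩ ⟨l, _, _, g, _, _⟩ h
  simp only [Sigma.mk.injEq, Fin.mk.injEq] at h
  obtain ⟨rfl, h⟩ := h
  obtain rfl := eq_of_heq h
  rfl

/-- The set `V_o` of the columns `(1, …, k)` with `2 ≤ k ≤ n - 1`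
(`V_c` consists of the other join-irreducible columns). -/
def orderPart (n : ℕ) : Set (PBWColumn n) :=
  {c | 2 ≤ c.len ∧ ∀ r, (c.entry r : ℕ) = r}

end PBWColumn

/-! ### The operation `⊙` of an interpolating polytope -/

section Odot

variable {L : Type*} [DistribLattice L]

/-- `ι a`: the order ideal of the join-irreducible elements below `a`. -/
def irredIdeal (a : L) : Set L := {p | SupIrred p ∧ p ≤ a}

/-- `K_{U_o,U_c}(J)`, for an order ideal `J` of join-irreducible elements: all elements of
`J ∩ U_o`, and those elements of `J ∩ U_c` that are maximal in `J`. -/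
def interpSet (Uo J : Set L) : Set L := {p | p ∈ J ∧ (p ∈ Uo ∨ ∀ q ∈ J, ¬ p < q)}

/-- `c = a ⊙ b`: the sum of the indicator functions of `K(ι a)` and `K(ι b)` is the sum of the
indicator functions of `K(ι a ∪ ι b)` and `K(ι c)`. -/
def IsOdot (Uo : Set L) (a b c : L) : Prop :=
  (interpSet Uo (irredIdeal a)).indicator (1 : L → ℕ) +
      (interpSet Uo (irredIdeal b)).indicator (1 : L → ℕ) =
    (interpSet Uo (irredIdeal a ∪ irredIdeal b)).indicator (1 : L → ℕ) +
      (interpSet Uo (irredIdeal c)).indicator (1 : L → ℕ)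

/-- In a finite distributive lattice, `a ⊙ b` is uniquely determined. -/
theorem IsOdot.unique [Finite L] {Uo : Set L} {a b c d : L} (hc : IsOdot Uo a b c)
    (hd : IsOdot Uo a b d) : c = d := by
  have hK : interpSet Uo (irredIdeal c) = interpSet Uo (irredIdeal d) :=
    Set.indicator_one_inj ℕ (add_left_cancel (hc.symm.trans hd))
  have key : ∀ x y : L, interpSet Uo (irredIdeal x) = interpSet Uo (irredIdeal y) → x ≤ y := by
    intro x y h
    have : Nonempty L := ⟨x⟩
    have := Fintype.ofFinite L
    let _ : OrderBot L := Fintype.toOrderBot L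
    obtain ⟨s, rfl, hs⟩ := exists_supIrred_decomposition x
    refine Finset.sup_le fun p hp => ?_
    obtain ⟨q, hpq, hq⟩ := (Set.toFinite (irredIdeal (s.sup id))).exists_le_maximal
      (show p ∈ irredIdeal (s.sup id) from ⟨hs hp, Finset.le_sup (f := id) hp⟩)
    have hq' : q ∈ interpSet Uo (irredIdeal (s.sup id)) :=
      ⟨hq.1, Or.inr fun r hr hlt => (hq.2 hr hlt.le).not_gt hlt⟩
    rw [h] at hq'
    exact hpq.trans hq'.1.2
  exact le_antisymm (key c d hK) (key d c hK.symm)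

end Odot

/-! ### The Plücker ideal -/

section Pluecker

open MvPolynomial

/-- The ring of polynomials in the Plücker variables `X_b`, one for each PBW-semistandard column
`b = (α₁, …, α_k)`; the variable `X_b` is `X_{α₁,…,α_k}`, which is alternating in its indices. -/
abbrev PlueckerRing (n : ℕ) : Type := MvPolynomial (PBWColumn n) ℂ

/-- The Plücker coordinate with index `b = (α₁, …, α_k)` of a square matrix `z`: the determinant of
the `k × k` matrix with entries `z_{i, α_j}`. -/
def plueckerCoord {A : Type*} [CommRing A] {n : ℕ} (z : Matrix (Fin n) (Fin n) A)
    (b : PBWColumn n) : A :=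
  (z.submatrix (Fin.castLE b.len_lt.le) b.entry).det

/-- The ideal of Plücker relations: all polynomial relations between the Plücker coordinates of a
generic `n × n` matrix. -/
noncomputable def plueckerIdeal (n : ℕ) : Ideal (PlueckerRing n) :=
  RingHom.ker (aeval (R := ℂ) (plueckerCoord (Matrix.mvPolynomialX (Fin n) (Fin n) ℂ))).toRingHom

/-- Equivalently, it is the vanishing ideal of (the multicone over) the variety of complete flags
in its Plücker embedding. -/
theorem mem_plueckerIdeal_iff {n : ℕ} {p : PlueckerRing n} :
    p ∈ plueckerIdeal n ↔
      ∀ g : Matrix (Fin n) (Fin n) ℂ, IsUnit g.det → eval (plueckerCoord g) p = 0 := by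
  set Z := Matrix.mvPolynomialX (Fin n) (Fin n) ℂ with hZ
  have hev : ∀ x : Fin n × Fin n → ℂ, eval x (aeval (R := ℂ) (plueckerCoord Z) p) =
      eval (plueckerCoord (Matrix.of fun i j => x (i, j))) p := by
    intro x
    have h1 : ((eval x).comp (aeval (R := ℂ) (plueckerCoord Z)).toRingHom) =
        eval (plueckerCoord (Matrix.of fun i j => x (i, j))) := by
      refine MvPolynomial.ringHom_ext (fun r => by simp) fun b => ?_
      simp only [RingHom.comp_apply, AlgHom.toRingHom_eq_coe, RingHom.coe_coe, aeval_X, eval_X,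
        plueckerCoord]
      rw [RingHom.map_det]
      congr 1
      ext i j
      simp [hZ, Matrix.mvPolynomialX]
    exact DFunLike.congr_fun h1 p
  have hdet : ∀ x : Fin n × Fin n → ℂ,
      eval x Z.det = (Matrix.of fun i j => x (i, j)).det := by
    intro x
    rw [RingHom.map_det]
    congr 1
    ext i j
    simp [hZ, Matrix.mvPolynomialX]
  have hmem : p ∈ plueckerIdeal n ↔ aeval (R := ℂ) (plueckerCoord Z) p = 0 := Iff.rfl
  rw [hmem]
  constructor
  · intro h g _
    have := hev fun ij => g ij.1 ij.2
    rw [h, map_zero] at this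
    exact this.symm
  · intro h
    have h0 : aeval (R := ℂ) (plueckerCoord Z) p * Z.det = 0 := by
      refine MvPolynomial.funext fun x => ?_
      rw [map_mul, hev, hdet, map_zero]
      by_cases hx : IsUnit (Matrix.of fun i j => x (i, j)).det
      · rw [h _ hx, zero_mul]
      · rw [isUnit_iff_ne_zero, not_not] at hx
        rw [hx, mul_zero]
    exact (mul_eq_zero.1 h0).resolve_right (Matrix.det_mvPolynomialX_ne_zero (Fin n) ℂ)

end Pluecker

/-! ### Straightening relations and algebras with straightening laws -/

/-- A monomial, given by its exponents, is standard if its factors are pairwise comparable. -/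
def IsStandardMonomial {Ω : Type*} [PartialOrder Ω] (d : Ω →₀ ℕ) : Prop :=
  ∀ a ∈ d.support, ∀ b ∈ d.support, a ≤ b ∨ b ≤ a

/-- `p` is a straightening relation for `X_a X_b` modulo the ideal `I`: an element of `I` of the
form `X_a X_b + Q`, with `Q` a linear combination of standard monomials. -/
def IsStraighteningRelation {Ω : Type*} [PartialOrder Ω] (I : Ideal (MvPolynomial Ω ℂ))
    (a b : Ω) (p : MvPolynomial Ω ℂ) : Prop :=
  p ∈ I ∧ ∀ d ∈ (p - MvPolynomial.X a * MvPolynomial.X b).support, IsStandardMonomial d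

/-- The commutative algebra `A` is an algebra with straightening laws on the finite poset `Ω` with
respect to the map `ε`. Weak chains `ω₁ ≤ … ≤ ω_m` are encoded by their multiplicities. -/
structure IsASL {Ω : Type*} [PartialOrder Ω] [Finite Ω] {A : Type*} [CommRing A] [Algebra ℂ A]
    (ε : Ω → A) : Prop where
  injective : Function.Injective ε
  /-- the standard monomials are linearly independent … -/
  linearIndependent : LinearIndependent ℂ
    fun d : {d : Ω →₀ ℕ // IsStandardMonomial d} => d.1.prod fun ω k => ε ω ^ k
  /-- … and span `A` -/
  span_eq_top : Submodule.span ℂ (Set.range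
    fun d : {d : Ω →₀ ℕ // IsStandardMonomial d} => d.1.prod fun ω k => ε ω ^ k) = ⊤
  /-- in the representation of `ε χ₁ * ε χ₂`, for incomparable `χ₁`, `χ₂`, as a linear combination
  of standard monomials, each monomial `ε ω₁ ⋯ ε ω_m` with `ω₁ ≤ … ≤ ω_m` that occurs satisfies
  `m ≥ 1`, `ω₁ ≤ χ₁` and `ω₁ ≤ χ₂` -/
  straightening : ∀ χ₁ χ₂ : Ω, ¬ χ₁ ≤ χ₂ → ¬ χ₂ ≤ χ₁ →
    ∀ c : {d : Ω →₀ ℕ // IsStandardMonomial d} →₀ ℂ,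
      ε χ₁ * ε χ₂ = (c.sum fun d x => x • d.1.prod fun ω k => ε ω ^ k) →
      ∀ d ∈ c.support, ∃ ω₁ ∈ d.1.support, (∀ ω ∈ d.1.support, ω₁ ≤ ω) ∧ ω₁ ≤ χ₁ ∧ ω₁ ≤ χ₂

/-!
An upper triangular matrix of monomials in auxiliary variables is chosen such that every Plücker
coordinate `X_a` has on it a componentwise least exponent, the leading exponent of `a`, and leading
exponents add up under products. The leading exponent of a standard monomial determines the
monomial: its support is that of its greatest column, which can be split off. Hence standard
monomials are linearly independent modulo the Plücker ideal. They span, because a Garnir relation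
rewrites the product of two incomparable columns, and each of its terms is smaller in a
lexicographic order on columns.

In the relation `X_a X_b = ∑ c_i X_{g_i} X_{h_i}` all leading exponents on the right are at least
that of `X_a X_b`, which gives `a ⊔ b ≤ h_i`, and exactly one of them is equal to it, with
coefficient `1` and `h = a ⊔ b`. All terms have the letters of `a` and `b` as their joint content,
so there is no other term with `h_i = a ⊔ b`. The bound `g_i ≤ a ⊓ b` is the bound `a ⊔ b ≤ h_i` for
the dual relation, obtained by replacing minors of a matrix with the complementary minors of its
inverse. Finally, mixed second differences of the leading exponents are indicator functions of the
sets `K(ι(a))`, so the equality of leading exponents says that `g = a ⊙ b`.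

The bounds on `g_i` and `h_i` alone turn straightening into a terminating procedure, which yields
the generation of the ideal, its minimality by comparing degrees, and the straightening laws.
-/

/-! ### Combinatorics of columns -/

theorem card_filter_fin_le_val (k s : ℕ) :
    (Finset.univ.filter fun c : Fin k => s ≤ (c : ℕ)).card = k - s := by
  have h := Finset.card_filter_add_card_filter_not (s := (Finset.univ : Finset (Fin k)))
    fun c => (c : ℕ) < s
  simp only [Fin.card_filter_val_lt, not_lt, Finset.card_univ, Fintype.card_fin] at h
  omega

theorem exists_strictAnti_of_card_eq {α β : Type*} [LinearOrder α] [LinearOrder β]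
    {s : Finset α} {t : Finset β} (h : s.card = t.card) : ∃ f : s → t, StrictAnti f :=
  ⟨fun x => t.orderIsoOfFin h.symm ((s.orderIsoOfFin rfl).symm x).rev, fun _ _ hxy =>
    (OrderIso.strictMono _) (Fin.rev_lt_rev.2 ((OrderIso.strictMono _) hxy))⟩

namespace PBWColumn

variable {n : ℕ} {a b : PBWColumn n}

theorem lt_prof_iff_exists_le {s m : ℕ} :
    m < a.prof s ↔ ∃ c : Fin a.len, s ≤ c ∧ m ≤ (a.entry c : ℕ) := by
  simp only [lt_prof_iff, Nat.lt_succ_iff]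

theorem le_iff_lt_prof : a ≤ b ↔ ∀ s m, m < a.prof s → m < b.prof s := by
  rw [le_iff_prof]
  exact ⟨fun h s m hm => hm.trans_le (h s), fun h s => le_of_forall_lt fun m => h s m⟩

theorem eq_of_lt_prof_iff (h : ∀ s m, m < a.prof s ↔ m < b.prof s) : a = b :=
  le_antisymm (le_iff_lt_prof.2 fun s m => (h s m).1) (le_iff_lt_prof.2 fun s m => (h s m).2)

theorem entry_injective (a : PBWColumn n) : Function.Injective a.entry := by
  refine Function.Injective.of_lt_imp_ne fun r s hrs h => ?_
  by_cases hr : (a.entry r : ℕ) < a.len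
  · exact hrs.ne (Fin.ext ((a.fixed r hr).symm.trans ((congrArg Fin.val h).trans
      (a.fixed s (h ▸ hr)))))
  · exact (a.decr r s hrs (not_lt.1 hr) (h ▸ not_lt.1 hr)).ne' h

/-- The set of letters of a column. It determines the column, and turns the straightening of
products of Plücker coordinates into counting. -/
def entries (a : PBWColumn n) : Finset (Fin n) := Finset.univ.image a.entry

theorem mem_entries {x : Fin n} : x ∈ a.entries ↔ ∃ c, a.entry c = x := by
  simp [entries]

theorem entry_mem_entries (a : PBWColumn n) (c : Fin a.len) : a.entry c ∈ a.entries :=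
  mem_entries.2 ⟨c, rfl⟩

theorem card_entries (a : PBWColumn n) : a.entries.card = a.len := by
  simp [entries, Finset.card_image_of_injective _ a.entry_injective]

theorem entry_lt_of_len_le {r s : Fin a.len} (hrs : r < s) (hr : a.len ≤ a.entry r) :
    a.entry s < a.entry r := by
  by_cases hs : a.len ≤ (a.entry s : ℕ)
  · exact a.decr r s hrs hr hs
  · exact Fin.lt_def.2 (by omega)

theorem le_pos_of_lt_prof {s m : ℕ} (h : m < a.prof s) {c : Fin a.len}
    (hs : s ≤ (a.entry c : ℕ)) (hm : (a.entry c : ℕ) < m) : s ≤ (c : ℕ) := by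
  obtain ⟨d, hd, hmd⟩ := lt_prof_iff_exists_le.1 h
  by_contra hc
  have hlen : a.len ≤ (a.entry c : ℕ) := by
    by_contra hl
    have := a.fixed c (by omega)
    omega
  have := entry_lt_of_len_le (Fin.lt_def.2 ((not_le.1 hc).trans_le hd)) hlen
  rw [Fin.lt_def] at this
  omega

theorem lt_pos_of_entry_lt {r c : Fin a.len} (hr : (r : ℕ) ≤ a.entry c)
    (h : a.entry c < a.entry r) : r < c :=
  lt_of_le_of_ne (le_pos_of_lt_prof (a.le_prof r le_rfl) hr h) fun hrc => h.ne (hrc ▸ rfl)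

/-- If the letters from position `s` on are all below `m`, then they are among the letters in
`[s, m)`; otherwise the letters in `[s, m)` all stand at or below position `s`, and miss one. -/
theorem lt_prof_iff_card {s m : ℕ} :
    m < a.prof s ↔
      s + (a.entries.filter fun x : Fin n => s ≤ (x : ℕ) ∧ (x : ℕ) < m).card < a.len := by
  rw [entries, Finset.filter_image, Finset.card_image_of_injective _ a.entry_injective]
  have hcard := card_filter_fin_le_val a.len s
  constructor
  · intro h
    obtain ⟨d, hd, hmd⟩ := lt_prof_iff_exists_le.1 h
    have hss : (Finset.univ.filter fun c => s ≤ (a.entry c : ℕ) ∧ (a.entry c : ℕ) < m) ⊂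
        Finset.univ.filter fun c : Fin a.len => s ≤ (c : ℕ) := by
      refine (Finset.ssubset_iff_of_subset fun c hc => ?_).2 ⟨d, by simpa using hd, by simp [hmd]⟩
      simp only [Finset.mem_filter, Finset.mem_univ, true_and] at hc ⊢
      exact le_pos_of_lt_prof h hc.1 hc.2
    have := Finset.card_lt_card hss
    omega
  · intro h
    by_contra hm
    have hss : (Finset.univ.filter fun c : Fin a.len => s ≤ (c : ℕ)) ⊆
        Finset.univ.filter fun c => s ≤ (a.entry c : ℕ) ∧ (a.entry c : ℕ) < m := by
      refine Finset.monotone_filter_right _ fun c _ hc => ⟨le_trans hc (a.le_entry c), ?_⟩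
      by_contra hmc
      exact hm (lt_prof_iff_exists_le.2 ⟨c, hc, not_lt.1 hmc⟩)
    have := Finset.card_le_card hss
    omega

theorem entries_injective : Function.Injective (entries (n := n)) := fun a b h =>
  eq_of_lt_prof_iff fun s m => by
    rw [lt_prof_iff_card, lt_prof_iff_card, ← card_entries a, ← card_entries b, h]

theorem exists_entries_eq {S : Finset (Fin n)} (hS : S.Nonempty) (hn : S.card < n) :
    ∃ a : PBWColumn n, a.entries = S := by
  let T : Finset (Fin n) := Finset.univ.filter fun x => (x : ℕ) < S.card
  have hT : ∀ {x}, x ∈ T ↔ (x : ℕ) < S.card := by simp [T]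
  obtain ⟨f, hf⟩ : ∃ f : ↥(T \ S) → ↥(S \ T), StrictAnti f :=
    exists_strictAnti_of_card_eq
      (Finset.card_sdiff_comm (by simp [T, Fin.card_filter_val_lt, hn.le]))
  have hfT : ∀ x, S.card ≤ (f x : Fin n) := fun x =>
    not_lt.1 fun h => (Finset.mem_sdiff.1 (f x).2).2 (hT.2 h)
  let g : Fin S.card → Fin n := fun r =>
    if h : Fin.castLE hn.le r ∈ S then Fin.castLE hn.le r
    else f ⟨Fin.castLE hn.le r, Finset.mem_sdiff.2 ⟨hT.2 r.2, h⟩⟩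
  have hg : ∀ r, S.card ≤ (g r : ℕ) → Fin.castLE hn.le r ∉ S := fun r hr h => by
    simp only [g, dif_pos h, Fin.val_castLE] at hr
    exact hr.not_gt r.2
  let a : PBWColumn n :=
    { len := S.card
      len_pos := hS.card_pos
      len_lt := hn
      entry := g
      fixed := fun r hr => by
        by_cases h : Fin.castLE hn.le r ∈ S
        · simp only [g, dif_pos h, Fin.val_castLE]
        · simp only [g, dif_neg h] at hr
          exact ((hfT _).not_gt hr).elim
      decr := fun r s hrs hr hs => by
        simp only [g, dif_neg (hg r hr), dif_neg (hg s hs)]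
        exact hf (Subtype.mk_lt_mk.2 (by simpa using hrs)) }
  refine ⟨a, Finset.eq_of_subset_of_card_le (fun x hx => ?_) a.card_entries.ge⟩
  obtain ⟨c, rfl⟩ := mem_entries.1 hx
  change g c ∈ S
  by_cases h : Fin.castLE hn.le c ∈ S
  · simpa only [g, dif_pos h] using h
  · simp only [g, dif_neg h]
    exact (Finset.mem_sdiff.1 (f _).2).1

/-- The profile of a column read from the bottom, in the lexicographic order: the order along which
straightening decreases. -/
def profLex (a : PBWColumn n) : Lex (Fin n → ℕ) := toLex fun i => a.prof i.rev

theorem profLex_lt {r : ℕ} (hr : a.prof r < b.prof r) (h : ∀ s, r < s → a.prof s ≤ b.prof s) :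
    a.profLex < b.profLex := by
  have hrn : r < n := lt_of_not_ge fun hc => by
    rw [b.prof_eq_zero (b.len_lt.le.trans hc)] at hr
    exact Nat.not_lt_zero _ hr
  let i : Fin n := Fin.rev ⟨r, hrn⟩
  have hi : (i.rev : ℕ) = r := by simp [i]
  refine lt_of_not_ge fun hle => ?_
  rcases hle.eq_or_lt with heq | ⟨j, hj, hlt⟩
  · have := congrFun (toLex.injective heq) i
    simp only [hi] at this
    exact hr.ne' this
  · change b.prof j.rev < a.prof j.rev at hlt
    rcases lt_trichotomy j i with hji | rfl | hij
    · exact hlt.not_ge (h _ (hi ▸ Fin.rev_lt_rev.2 hji))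
    · rw [hi] at hlt
      exact hlt.not_gt hr
    · have := hj i hij
      change b.prof i.rev = a.prof i.rev at this
      rw [hi] at this
      exact hr.ne' this

/-- The effect of an exchange in a Garnir relation. -/
theorem profLex_lt_of_exchange {r : Fin b.len} (hr : b.len ≤ b.entry r) (hlen : a.len = b.len)
    (hmem : ∀ c, r < c → b.entry c ∈ a.entries)
    (hx : ∃ x ∈ a.entries, (r : ℕ) ≤ x ∧ x < b.entry r ∧ ∀ c, r < c → b.entry c ≠ x) :
    a.profLex < b.profLex := by
  have hbelow : ∀ s m : ℕ, (r : ℕ) ≤ s → m ≤ b.entry r → m < a.prof s → m < b.prof s := by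
    intro s m hs hm h
    rw [lt_prof_iff_card, hlen] at h
    rw [lt_prof_iff_card]
    refine lt_of_le_of_lt (Nat.add_le_add_left (Finset.card_le_card fun x hx => ?_) s) h
    obtain ⟨hxb, hsx, hxm⟩ := Finset.mem_filter.1 hx
    obtain ⟨c, rfl⟩ := mem_entries.1 hxb
    exact Finset.mem_filter.2 ⟨hmem c (lt_pos_of_entry_lt (hs.trans hsx)
      (Fin.lt_def.2 (hxm.trans_le hm))), hsx, hxm⟩
  have hdrop : a.prof r ≤ b.entry r := by
    obtain ⟨x, hxa, hrx, hxr, hne⟩ := hx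
    have hsub : insert x ((Finset.Ioi r).image b.entry) ⊆
        a.entries.filter fun y => (r : ℕ) ≤ (y : ℕ) ∧ (y : ℕ) < b.entry r := by
      refine Finset.insert_subset (Finset.mem_filter.2 ⟨hxa, hrx, hxr⟩) fun y hy => ?_
      obtain ⟨c, hc, rfl⟩ := Finset.mem_image.1 hy
      rw [Finset.mem_Ioi] at hc
      exact Finset.mem_filter.2 ⟨hmem c hc, (Fin.lt_def.1 hc).le.trans (b.le_entry c),
        entry_lt_of_len_le hc hr⟩
    have hcard := Finset.card_le_card hsub
    rw [Finset.card_insert_of_notMem (by simpa using hne),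
      Finset.card_image_of_injective _ b.entry_injective, Fin.card_Ioi] at hcard
    refine not_lt.1 fun h => ?_
    rw [lt_prof_iff_card] at h
    omega
  refine profLex_lt (hdrop.trans_lt (b.le_prof r le_rfl)) fun s hs =>
    le_of_forall_lt fun m hm => hbelow s m hs.le ?_ hm
  exact (hm.le.trans (a.prof_antitone hs.le)).trans hdrop

end PBWColumn

/-! ### Quadratic straightening -/

section Garnir

open Equiv.Perm

/-- The source of the Garnir relations. -/
theorem sum_sign_smul_map_perm_eq_zero {A M N ι κ : Type*} [CommRing A] [AddCommGroup M]
    [Module A M] [AddCommGroup N] [Module A N] [DecidableEq ι] [Fintype ι] [Fintype κ]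
    (e : Module.Basis κ A M) (f : MultilinearMap A (fun _ : ι => M) N) (w : ι → M)
    (P : ι → Prop) [DecidablePred P] (hP : Fintype.card κ < Fintype.card {i // P i}) :
    ∑ σ : Equiv.Perm {i // P i}, sign σ • f (w ∘ ofSubtype σ) = 0 := by
  have halt : MultilinearMap.alternatization (f.domDomRestrict P fun i => w i) = 0 :=
    Module.Basis.ext_alternating e fun v hv =>
      (hP.not_ge (Fintype.card_le_of_injective v hv)).elim
  have h := DFunLike.congr_fun halt fun i : {i // P i} => w i
  rw [MultilinearMap.alternatization_apply, AlternatingMap.zero_apply] at h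
  rw [← h]
  refine Finset.sum_congr rfl fun σ _ => ?_
  rw [MultilinearMap.domDomCongr_apply, MultilinearMap.domDomRestrict_apply]
  congr 2
  funext i
  split_ifs with hi
  · simp only [Function.comp_apply, ofSubtype_apply_of_mem σ hi]
  · simp only [Function.comp_apply, ofSubtype_apply_of_not_mem σ hi]

variable {A : Type*} [CommRing A] {n k l : ℕ}

/-- The minor of `z` on its first `k` rows and the columns `γ`. -/
def topMinor (z : Matrix (Fin n) (Fin n) A) (hk : k ≤ n) (γ : Fin k → Fin n) : A :=
  (z.submatrix (Fin.castLE hk) γ).det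

theorem topMinor_entry (z : Matrix (Fin n) (Fin n) A) (a : PBWColumn n) :
    topMinor z a.len_lt.le a.entry = plueckerCoord z a := rfl

theorem topMinor_comp_perm (z : Matrix (Fin n) (Fin n) A) (hk : k ≤ n) (γ : Fin k → Fin n)
    (σ : Equiv.Perm (Fin k)) : topMinor z hk (γ ∘ σ) = sign σ • topMinor z hk γ := by
  rw [Units.smul_def, zsmul_eq_mul]
  exact Matrix.det_permute' σ (z.submatrix (Fin.castLE hk) γ)

theorem topMinor_eq_zero (z : Matrix (Fin n) (Fin n) A) (hk : k ≤ n) {γ : Fin k → Fin n}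
    (hγ : ¬ Function.Injective γ) : topMinor z hk γ = 0 := by
  obtain ⟨i, j, h, hij⟩ := Function.not_injective_iff.1 hγ
  exact Matrix.det_zero_of_column_eq hij fun x => by simp [h]

theorem exists_topMinor_eq_smul_plueckerCoord (z : Matrix (Fin n) (Fin n) A) (hk : 0 < k)
    (hkn : k < n) {γ : Fin k → Fin n} (hγ : Function.Injective γ) :
    ∃ (a : PBWColumn n) (ε : ℤˣ), a.len = k ∧ a.entries = Finset.univ.image γ ∧
      topMinor z hkn.le γ = ε • plueckerCoord z a := by
  have hcard : (Finset.univ.image γ).card = k := by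
    rw [Finset.card_image_of_injective _ hγ, Finset.card_univ, Fintype.card_fin]
  obtain ⟨a, ha⟩ := PBWColumn.exists_entries_eq (Finset.card_pos.1 (hcard.symm ▸ hk))
    (hcard.symm ▸ hkn)
  obtain rfl : a.len = k := by rw [← a.card_entries, ha, hcard]
  have hex : ∀ i, ∃ j, a.entry j = γ i := fun i => PBWColumn.mem_entries.1 (by simp [ha])
  choose π hπ using hex
  have hπ_inj : Function.Injective π := fun i j h => hγ (by rw [← hπ, ← hπ, h])
  let σ : Equiv.Perm (Fin a.len) :=
    Equiv.ofBijective π (Finite.injective_iff_bijective.1 hπ_inj)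
  refine ⟨a, sign σ, rfl, ha, ?_⟩
  rw [show γ = a.entry ∘ σ from funext fun i => (hπ i).symm, topMinor_comp_perm, topMinor_entry]

/-- The product of the top minors of `z` whose columns are the two blocks of `v`. -/
def minorProd (z : Matrix (Fin n) (Fin n) A) (hl : l ≤ k) (hk : k ≤ n)
    (v : Fin k ⊕ Fin l → Fin n) : A :=
  topMinor z hk (v ∘ Sum.inl) * topMinor z (hl.trans hk) (v ∘ Sum.inr)

variable (z : Matrix (Fin n) (Fin n) A) (hl : l ≤ k) (hk : k ≤ n) (v : Fin k ⊕ Fin l → Fin n)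

theorem sum_sign_smul_minorProd_eq_zero (P : Fin k ⊕ Fin l → Prop) [DecidablePred P]
    (hP : k < Fintype.card {i // P i}) :
    ∑ σ : Equiv.Perm {i // P i}, sign σ • minorProd z hl hk (v ∘ ofSubtype σ) = 0 := by
  let f : MultilinearMap A (fun _ : Fin k ⊕ Fin l => Fin k → A) A :=
    (LinearMap.mul' A A).compMultilinearMap
      (MultilinearMap.domCoprod (Matrix.detRowAlternating (R := A) (n := Fin k)).toMultilinearMap
        ((Matrix.detRowAlternating (R := A) (n := Fin l)).compLinearMap
          (LinearMap.funLeft A A (Fin.castLE hl))).toMultilinearMap)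
  have hf : ∀ u : Fin k ⊕ Fin l → Fin n,
      f (fun i j => z (Fin.castLE hk j) (u i)) = minorProd z hl hk u := fun u => by
    rw [minorProd, topMinor, topMinor, ← Matrix.det_transpose, ← Matrix.det_transpose
      (z.submatrix (Fin.castLE (hl.trans hk)) _)]
    rfl
  simp only [← hf]
  exact sum_sign_smul_map_perm_eq_zero (Pi.basisFun A (Fin k)) f
    (fun i j => z (Fin.castLE hk j) (v i)) P (by simpa using hP)

theorem sign_smul_minorProd_of_mapsTo {σ : Equiv.Perm (Fin k ⊕ Fin l)}
    (hσ : Set.MapsTo σ (Set.range Sum.inl) (Set.range Sum.inl)) :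
    sign σ • minorProd z hl hk (v ∘ σ) = minorProd z hl hk v := by
  obtain ⟨⟨σ₁, σ₂⟩, rfl⟩ := mem_sumCongrHom_range_of_perm_mapsTo_inl hσ
  change sign (Equiv.Perm.sumCongr σ₁ σ₂) • (topMinor z hk ((v ∘ Sum.inl) ∘ σ₁) *
    topMinor z (hl.trans hk) ((v ∘ Sum.inr) ∘ σ₂)) = _
  rw [topMinor_comp_perm, topMinor_comp_perm, smul_mul_smul_comm, smul_smul, sign_sumCongr,
    Int.units_mul_self, one_smul, minorProd]

theorem minorProd_mem {k l : ℕ} (hl : l ≤ k) (hk : k < n) (hl₀ : 0 < l) (W : AddSubgroup A)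
    (v : Fin k ⊕ Fin l → Fin n)
    (hW : ∀ a b : PBWColumn n, a.len = k → b.len = l → Function.Injective (v ∘ Sum.inr) →
      b.entries = Finset.univ.image (v ∘ Sum.inr) →
      a.entries.val + b.entries.val = Finset.univ.val.map v →
      plueckerCoord z a * plueckerCoord z b ∈ W) :
    minorProd z hl hk.le v ∈ W := by
  rw [minorProd]
  by_cases hα : Function.Injective (v ∘ Sum.inl)
  swap
  · rw [topMinor_eq_zero z _ hα, zero_mul]
    exact W.zero_mem
  by_cases hβ : Function.Injective (v ∘ Sum.inr)
  swap
  · rw [topMinor_eq_zero z _ hβ, mul_zero]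
    exact W.zero_mem
  obtain ⟨a, ε, ha, hae, haz⟩ :=
    exists_topMinor_eq_smul_plueckerCoord z (hl₀.trans_le hl) hk hα
  obtain ⟨b, δ, hb, hbe, hbz⟩ :=
    exists_topMinor_eq_smul_plueckerCoord z hl₀ (hl.trans_lt hk) hβ
  rw [haz, hbz, smul_mul_smul_comm, Units.smul_def]
  refine W.zsmul_mem (hW a b ha hb hβ hbe ?_) _
  rw [hae, hbe, Finset.image_val_of_injOn hα.injOn, Finset.image_val_of_injOn hβ.injOn,
    ← Finset.univ_disjSum_univ, Finset.val_disjSum, Multiset.map_disjSum]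
  rfl

end Garnir

theorem mem_of_sum_eq_zero {𝕜 M ι : Type*} [Field 𝕜] [CharZero 𝕜] [AddCommGroup M] [Module 𝕜 M]
    [Fintype ι] (W : Submodule 𝕜 M) {t : ι → M} {x : M} (hsum : ∑ i, t i = 0)
    (ht : ∀ i, t i = x ∨ t i ∈ W) {i₀ : ι} (hi₀ : t i₀ = x) : x ∈ W := by
  classical
  rw [← Finset.sum_filter_add_sum_filter_not _ (t · = x),
    Finset.sum_congr rfl fun i hi => (Finset.mem_filter.1 hi).2, Finset.sum_const,
    ← Nat.cast_smul_eq_nsmul 𝕜, add_eq_zero_iff_eq_neg] at hsum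
  have hcard : (Finset.univ.filter (t · = x)).card ≠ 0 :=
    Finset.card_ne_zero_of_mem (Finset.mem_filter.2 ⟨Finset.mem_univ i₀, hi₀⟩)
  rw [← W.smul_mem_iff (Nat.cast_ne_zero (R := 𝕜).2 hcard), hsum]
  exact W.neg_mem (W.sum_mem fun i hi => (ht i).resolve_left (Finset.mem_filter.1 hi).2)

/-- For columns of lengths `k` and `l`, the slots permuted in the Garnir relation at position `r`:
the positions from `r` on in the first column and the positions up to `r` in the second one. -/
def garnirSlot (k l r : ℕ) : Fin k ⊕ Fin l → Prop :=
  Sum.elim (fun c => r ≤ c) fun c => (c : ℕ) ≤ r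

instance (k l r : ℕ) : DecidablePred (garnirSlot k l r) := by
  rintro (c | c) <;> simp only [garnirSlot, Sum.elim_inl, Sum.elim_inr] <;> infer_instance

theorem card_garnirSlot {k l r : ℕ} (hr : r < l) (hl : l ≤ k) :
    Fintype.card {i // garnirSlot k l r i} = k + 1 := by
  rw [Fintype.card_congr Equiv.subtypeSum, Fintype.card_sum, Fintype.card_subtype,
    Fintype.card_subtype]
  have hle := card_filter_fin_le_val k r
  have hlt := Fin.card_filter_val_lt (n := l) (m := r + 1)
  simp only [Nat.lt_succ_iff] at hlt
  simp only [garnirSlot, Sum.elim_inl, Sum.elim_inr, hle, hlt]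
  omega

namespace PBWColumn

variable {n : ℕ} {a b : PBWColumn n}

theorem exists_entry_lt_of_not_le (hlen : b.len ≤ a.len) (hab : ¬ b ≤ a) :
    ∃ r : Fin b.len, b.len ≤ b.entry r ∧ ∀ s : Fin a.len, (r : ℕ) ≤ s → a.entry s < b.entry r := by
  rw [le_def] at hab
  push Not at hab
  obtain ⟨r, hr⟩ := hab hlen
  refine ⟨r, not_lt.1 fun h => ?_, hr⟩
  have h1 := b.fixed r h
  have h2 := Fin.lt_def.1 (hr ⟨r, r.2.trans_le hlen⟩ le_rfl)
  have h3 := a.le_entry ⟨r, r.2.trans_le hlen⟩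
  simp only at h3
  omega

theorem profLex_lt_of_perm_garnirSlot {r : Fin b.len} (hr : b.len ≤ b.entry r)
    (hra : ∀ s : Fin a.len, (r : ℕ) ≤ s → a.entry s < b.entry r)
    {σ : Equiv.Perm {i // garnirSlot a.len b.len r i}} {c₀ : Fin b.len} {d₀ : Fin a.len}
    (hσ : Equiv.Perm.ofSubtype σ (Sum.inr c₀) = Sum.inl d₀) {b' : PBWColumn n}
    (hlen : b'.len = b.len)
    (hinj : Function.Injective (Sum.elim a.entry b.entry ∘ Equiv.Perm.ofSubtype σ ∘ Sum.inr))
    (hb' : b'.entries =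
      Finset.univ.image (Sum.elim a.entry b.entry ∘ Equiv.Perm.ofSubtype σ ∘ Sum.inr)) :
    b'.profLex < b.profLex := by
  set β := Sum.elim a.entry b.entry ∘ Equiv.Perm.ofSubtype σ ∘ Sum.inr with hβ
  have hβ_mem : ∀ c, β c ∈ b'.entries := fun c =>
    hb' ▸ Finset.mem_image_of_mem β (Finset.mem_univ c)
  have hβ_fixed : ∀ c, r < c → β c = b.entry c := fun c hc => by
    have : ¬ garnirSlot a.len b.len r (Sum.inr c) := not_le.2 (Fin.lt_def.1 hc)
    simp only [hβ, Function.comp_apply, Equiv.Perm.ofSubtype_apply_of_not_mem σ this, Sum.elim_inr]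
  have hβ₀ : β c₀ = a.entry d₀ := by simp [hβ, hσ]
  have hc₀ : garnirSlot a.len b.len r (Sum.inr c₀) := by
    by_contra h
    rw [Equiv.Perm.ofSubtype_apply_of_not_mem σ h] at hσ
    cases hσ
  have hd₀ : (r : ℕ) ≤ d₀ := by
    have h := (σ ⟨_, hc₀⟩).2
    rwa [← Equiv.Perm.ofSubtype_apply_of_mem σ hc₀, hσ] at h
  refine profLex_lt_of_exchange hr hlen (fun c hc => hβ_fixed c hc ▸ hβ_mem c)
    ⟨a.entry d₀, hβ₀ ▸ hβ_mem c₀, hd₀.trans (a.le_entry d₀), hra d₀ hd₀, fun c hc h => ?_⟩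
  rw [← hβ_fixed c hc, ← hβ₀] at h
  exact (not_lt.2 hc₀) (Fin.lt_def.1 (hinj h ▸ hc))

variable {𝕜 A : Type*} [Field 𝕜] [CharZero 𝕜] [CommRing A] [Algebra 𝕜 A]

open Equiv.Perm in
theorem plueckerCoord_mul_mem_of_exchange (z : Matrix (Fin n) (Fin n) A) (W : Submodule 𝕜 A)
    (hlen : b.len ≤ a.len) (hab : ¬ b ≤ a)
    (hW : ∀ a' b' : PBWColumn n, a'.len = a.len → b'.len = b.len → b'.profLex < b.profLex →
      a'.entries.val + b'.entries.val = a.entries.val + b.entries.val →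
      plueckerCoord z a' * plueckerCoord z b' ∈ W) :
    plueckerCoord z a * plueckerCoord z b ∈ W := by
  obtain ⟨r, hr, hra⟩ := exists_entry_lt_of_not_le hlen hab
  let v : Fin a.len ⊕ Fin b.len → Fin n := Sum.elim a.entry b.entry
  have hv : Finset.univ.val.map v = a.entries.val + b.entries.val := by
    rw [entries, entries, Finset.image_val_of_injOn a.entry_injective.injOn,
      Finset.image_val_of_injOn b.entry_injective.injOn, ← Finset.univ_disjSum_univ,
      Finset.val_disjSum, Multiset.map_disjSum]
    rfl
  refine mem_of_sum_eq_zero (i₀ := 1) W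
    (sum_sign_smul_minorProd_eq_zero z hlen a.len_lt.le v (garnirSlot a.len b.len r)
      (by rw [card_garnirSlot r.2 hlen]; exact Nat.lt_succ_self _)) (fun σ => ?_)
    (by rw [Equiv.Perm.sign_one, one_smul, map_one]; rfl)
  by_cases hσ : Set.MapsTo (ofSubtype σ) (Set.range Sum.inr) (Set.range Sum.inr)
  · left
    rw [← sign_ofSubtype]
    exact sign_smul_minorProd_of_mapsTo z hlen _ v ((perm_mapsTo_inl_iff_mapsTo_inr _).2 hσ)
  right
  obtain ⟨c₀, d₀, hcd⟩ : ∃ c₀ d₀, ofSubtype σ (Sum.inr c₀) = Sum.inl d₀ := by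
    by_contra! hno
    refine hσ (Set.mapsTo_range_iff.2 fun c => ?_)
    rcases h : ofSubtype σ (Sum.inr c) with d | d
    · exact (hno c d h).elim
    · exact ⟨d, rfl⟩
  rw [Units.smul_def]
  refine zsmul_mem (minorProd_mem z hlen a.len_lt b.len_pos W.toAddSubgroup _
    fun a' b' ha' hb' hinj hb'e hcont => hW a' b' ha' hb'
      (profLex_lt_of_perm_garnirSlot hr hra hcd hb' hinj hb'e) ?_) _
  rw [hcont, ← hv, ← Multiset.map_map v (ofSubtype σ), Multiset.map_univ_val_equiv]

theorem plueckerCoord_mul_mem_span_standard (z : Matrix (Fin n) (Fin n) A) (a b : PBWColumn n) :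
    plueckerCoord z a * plueckerCoord z b ∈ Submodule.span 𝕜
      {x | ∃ g h : PBWColumn n, g ≤ h ∧
        g.entries.val + h.entries.val = a.entries.val + b.entries.val ∧
        x = plueckerCoord z g * plueckerCoord z h} := by
  wlog hlen : b.len ≤ a.len generalizing a b
  · rw [mul_comm, add_comm a.entries.val]
    exact this b a (le_of_not_ge hlen)
  induction hb : b.profLex using WellFoundedLT.induction generalizing a b with
  | ind L ih =>
    by_cases hab : b ≤ a
    · exact Submodule.subset_span ⟨b, a, hab, add_comm _ _, mul_comm _ _⟩
    · refine plueckerCoord_mul_mem_of_exchange z _ hlen hab fun a' b' ha' hb' hlt hcont => ?_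
      rw [← hcont]
      exact ih _ (hb ▸ hlt) a' b' (ha' ▸ hb' ▸ hlen) rfl

end PBWColumn

/-! ### Polynomials with a least exponent -/

section LeastExponent

open MvPolynomial

variable {R σ ι : Type*} [CommSemiring R] {f g : MvPolynomial σ R} {d e : σ →₀ ℕ}

theorem coeff_add_mul_of_mem_lowerBounds (hd : d ∈ lowerBounds (f.support : Set (σ →₀ ℕ)))
    (he : e ∈ lowerBounds (g.support : Set (σ →₀ ℕ))) :
    coeff (d + e) (f * g) = coeff d f * coeff e g := by
  classical
  rw [coeff_mul, Finset.sum_eq_single (d, e)]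
  · rintro ⟨d', e'⟩ hsum hne
    by_contra hmul
    have hd' : d ≤ d' := hd (mem_support_iff.2 (left_ne_zero_of_mul hmul))
    have he' : e ≤ e' := he (mem_support_iff.2 (right_ne_zero_of_mul hmul))
    obtain ⟨rfl, rfl⟩ := (add_eq_add_iff_eq_and_eq hd' he').1
      (Finset.HasAntidiagonal.mem_antidiagonal.1 hsum).symm
    exact hne rfl
  · exact fun h => (h (Finset.HasAntidiagonal.mem_antidiagonal.2 rfl)).elim

theorem isLeast_support_mul [NoZeroDivisors R] (hf : IsLeast (f.support : Set (σ →₀ ℕ)) d)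
    (hg : IsLeast (g.support : Set (σ →₀ ℕ)) e) :
    IsLeast ((f * g).support : Set (σ →₀ ℕ)) (d + e) := by
  classical
  refine ⟨mem_support_iff.2 ?_, fun x hx => ?_⟩
  · rw [coeff_add_mul_of_mem_lowerBounds hf.2 hg.2]
    exact mul_ne_zero (mem_support_iff.1 hf.1) (mem_support_iff.1 hg.1)
  · obtain ⟨y, hy, z, hz, rfl⟩ := Finset.mem_add.1 (support_mul f g hx)
    exact add_le_add (hf.2 hy) (hg.2 hz)

theorem isLeast_support_one [Nontrivial R] :
    IsLeast ((1 : MvPolynomial σ R).support : Set (σ →₀ ℕ)) 0 :=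
  ⟨mem_support_iff.2 (by simp), fun _ _ => zero_le⟩

theorem isLeast_support_pow [NoZeroDivisors R] [Nontrivial R]
    (hf : IsLeast (f.support : Set (σ →₀ ℕ)) d) (k : ℕ) :
    IsLeast ((f ^ k).support : Set (σ →₀ ℕ)) (k • d) := by
  induction k with
  | zero =>
    rw [pow_zero, zero_nsmul]
    exact isLeast_support_one
  | succ k ih => simpa only [pow_succ, succ_nsmul] using isLeast_support_mul ih hf

theorem isLeast_support_prod_pow [NoZeroDivisors R] [Nontrivial R] {F : ι → MvPolynomial σ R}
    {E : ι → σ →₀ ℕ} (hF : ∀ i, IsLeast ((F i).support : Set (σ →₀ ℕ)) (E i)) (d : ι →₀ ℕ) :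
    IsLeast ((d.prod fun i k => F i ^ k).support : Set (σ →₀ ℕ))
      (Finsupp.linearCombination ℕ E d) := by
  classical
  rw [Finsupp.linearCombination_apply, Finsupp.sum, Finsupp.prod]
  induction d.support using Finset.induction_on with
  | empty => exact isLeast_support_one
  | insert i s hi ih =>
    rw [Finset.prod_insert hi, Finset.sum_insert hi]
    exact isLeast_support_mul (isLeast_support_pow (hF i) _) ih

section LinearCombination

variable [NoZeroDivisors R] {F : ι → MvPolynomial σ R} {E : ι → σ →₀ ℕ} {c : ι →₀ R}

theorem exists_le_mem_support_linearCombination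
    (hF : ∀ i, IsLeast ((F i).support : Set (σ →₀ ℕ)) (E i)) (hE : Set.InjOn E c.support) {i : ι}
    (hi : i ∈ c.support) : ∃ j, E j ≤ E i ∧ E j ∈ (Finsupp.linearCombination R F c).support := by
  obtain ⟨e, hei, ⟨j, hj, rfl⟩, hmin⟩ := ((c.support.finite_toSet).image E).exists_le_minimal
    (Set.mem_image_of_mem E hi)
  refine ⟨j, hei, mem_support_iff.2 ?_⟩
  rw [Finsupp.linearCombination_apply, Finsupp.sum, coeff_sum, Finset.sum_eq_single j]
  · rw [coeff_smul, smul_eq_mul]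
    exact mul_ne_zero (Finsupp.mem_support_iff.1 hj) (mem_support_iff.1 (hF j).1)
  · intro k hk hkj
    by_contra h
    have hle : E k ≤ E j := (hF k).2 (mem_support_iff.2 (right_ne_zero_of_smul h))
    exact hkj (hE hk hj (hle.antisymm (hmin (Set.mem_image_of_mem E hk) hle)))
  · exact fun h => (h hj).elim

theorem le_of_isLeast_support_linearCombination
    (hF : ∀ i, IsLeast ((F i).support : Set (σ →₀ ℕ)) (E i)) (hE : Set.InjOn E c.support)
    (he : IsLeast ((Finsupp.linearCombination R F c).support : Set (σ →₀ ℕ)) e) {i : ι}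
    (hi : i ∈ c.support) : e ≤ E i :=
  have ⟨_, hji, hj⟩ := exists_le_mem_support_linearCombination hF hE hi
  (he.2 hj).trans hji

theorem exists_eq_of_isLeast_support_linearCombination
    (hF : ∀ i, IsLeast ((F i).support : Set (σ →₀ ℕ)) (E i)) (hE : Set.InjOn E c.support)
    (he : IsLeast ((Finsupp.linearCombination R F c).support : Set (σ →₀ ℕ)) e) :
    ∃ i ∈ c.support, E i = e ∧
      c i * coeff e (F i) = coeff e (Finsupp.linearCombination R F c) := by
  have heq : ∀ i ∈ c.support, coeff e (c i • F i) ≠ 0 → E i = e := fun i hi hne =>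
    ((hF i).2 (mem_support_iff.2 (right_ne_zero_of_mul (coeff_smul e (c i) (F i) ▸ hne)))).antisymm
      (le_of_isLeast_support_linearCombination hF hE he hi)
  have hsum : coeff e (Finsupp.linearCombination R F c) =
      ∑ i ∈ c.support, coeff e (c i • F i) := by
    rw [Finsupp.linearCombination_apply, Finsupp.sum, coeff_sum]
  obtain ⟨i, hi, hne⟩ := Finset.exists_ne_zero_of_sum_ne_zero (hsum ▸ mem_support_iff.1 he.1)
  refine ⟨i, hi, heq i hi hne, ?_⟩
  rw [hsum, Finset.sum_eq_single_of_mem i hi, coeff_smul, smul_eq_mul]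
  intro j hj hji
  by_contra hne'
  exact hji (hE hj hi ((heq j hj hne').trans (heq i hi hne).symm))

theorem eq_zero_of_aeval_eq_zero {R : Type*} [CommRing R] [IsDomain R] {F : ι → MvPolynomial σ R}
    (hF : ∀ i, IsLeast ((F i).support : Set (σ →₀ ℕ)) (E i)) {q : MvPolynomial ι R}
    (hq : Set.InjOn (Finsupp.linearCombination ℕ E) q.support) (h : aeval F q = 0) : q = 0 := by
  by_contra h0
  obtain ⟨d, hd⟩ := support_nonempty.2 h0
  obtain ⟨d', -, hd'⟩ := exists_le_mem_support_linearCombination (c := AddMonoidAlgebra.coeff q)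
    (isLeast_support_prod_pow hF) hq hd
  have : Finsupp.linearCombination R (fun d : ι →₀ ℕ => d.prod fun i k => F i ^ k)
      (AddMonoidAlgebra.coeff q) = 0 := by
    rw [← h, aeval_def, eval₂_eq, Finsupp.linearCombination_apply]
    exact Finset.sum_congr rfl fun d _ => Algebra.smul_def _ _
  rw [this] at hd'
  simp at hd'

end LinearCombination

end LeastExponent

/-! ### Leading terms of Plücker coordinates -/

section Rectangles

variable {ι : Type*} [Fintype ι]

/-- The indicator function of the rectangle `[0, p.1] × [0, p.2]`. Sums of such functions serve as
exponents of monomials. -/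
noncomputable def rectExp (p : ℕ × ℕ) : ℕ × ℕ →₀ ℕ :=
  Finsupp.indicator (Finset.Iic p) fun _ _ => 1

theorem sum_rectExp_apply (x : ι → ℕ × ℕ) (p : ℕ × ℕ) :
    (∑ c, rectExp (x c)) p = (Finset.univ.filter fun c => p ≤ x c).card := by
  simp [rectExp, Finsupp.finsetSum_apply, Finsupp.indicator_apply, Finset.sum_boole]

/-- The rectangles in a sum can be read off from its mixed second differences. -/
theorem sum_rectExp_add_sum_rectExp (x : ι → ℕ × ℕ) (s m : ℕ) :
    (∑ c, rectExp (x c)) (s, m) + (∑ c, rectExp (x c)) (s + 1, m + 1) =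
      (∑ c, rectExp (x c)) (s + 1, m) + (∑ c, rectExp (x c)) (s, m + 1) +
        (Finset.univ.filter fun c => x c = (s, m)).card := by
  simp only [sum_rectExp_apply, Finset.card_filter, ← Finset.sum_add_distrib]
  refine Finset.sum_congr rfl fun c _ => ?_
  simp only [Prod.le_def, Prod.ext_iff]
  grind

theorem card_filter_eq_of_sum_rectExp_eq {x y : ι → ℕ × ℕ}
    (h : ∑ c, rectExp (x c) = ∑ c, rectExp (y c)) (p : ℕ × ℕ) :
    (Finset.univ.filter fun c => x c = p).card = (Finset.univ.filter fun c => y c = p).card := by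
  have hx := sum_rectExp_add_sum_rectExp x p.1 p.2
  have hy := sum_rectExp_add_sum_rectExp y p.1 p.2
  rw [h] at hx
  exact Nat.add_left_cancel (hx.symm.trans hy)

end Rectangles

open MvPolynomial in
/-- An upper triangular matrix of monomials on which every Plücker coordinate has a least
exponent. -/
noncomputable def rectMatrix (R : Type*) [CommRing R] (n : ℕ) :
    Matrix (Fin n) (Fin n) (MvPolynomial (ℕ × ℕ) R) :=
  Matrix.of fun i j => if i ≤ j then monomial (rectExp (i, j)) 1 else 0

namespace PBWColumn

open MvPolynomial

variable {n : ℕ} {a b g h : PBWColumn n} {R : Type*} [CommRing R]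

/-- The least exponent of a Plücker coordinate on `rectMatrix`. -/
noncomputable def leadExp (a : PBWColumn n) : ℕ × ℕ →₀ ℕ :=
  ∑ c : Fin a.len, rectExp (c, a.entry c)

/-- The exponent that a permutation contributes to a Plücker coordinate on `rectMatrix`. -/
noncomputable def permExp (a : PBWColumn n) (σ : Equiv.Perm (Fin a.len)) : ℕ × ℕ →₀ ℕ :=
  ∑ c, rectExp (σ c, a.entry c)

theorem permExp_one (a : PBWColumn n) : a.permExp 1 = a.leadExp := rfl

theorem leadExp_le_permExp {σ : Equiv.Perm (Fin a.len)} (hσ : ∀ c, (σ c : ℕ) ≤ a.entry c) :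
    a.leadExp ≤ a.permExp σ := by
  rintro ⟨s, m⟩
  rw [leadExp, permExp, sum_rectExp_apply, sum_rectExp_apply]
  simp only [Prod.mk_le_mk]
  rcases le_or_gt (a.prof s) m with hm | hm
  · rw [Finset.filter_false_of_mem fun c _ hc =>
      hm.not_gt (lt_prof_iff_exists_le.2 ⟨c, hc⟩), Finset.card_empty]
    exact Nat.zero_le _
  have hσs : (Finset.univ.filter fun c : Fin a.len => s ≤ (σ c : ℕ)).card =
      (Finset.univ.filter fun c : Fin a.len => s ≤ (c : ℕ)).card :=
    Finset.card_equiv σ (by simp)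
  have hσm : (Finset.univ.filter fun c => s ≤ (σ c : ℕ) ∧ ¬ m ≤ (a.entry c : ℕ)).card ≤
      (Finset.univ.filter fun c : Fin a.len => s ≤ (c : ℕ) ∧ ¬ m ≤ (a.entry c : ℕ)).card :=
    Finset.card_le_card <| Finset.monotone_filter_right _ fun c _ hc =>
      ⟨le_pos_of_lt_prof hm (hc.1.trans (hσ c)) (not_le.1 hc.2), hc.2⟩
  have hid := Finset.card_filter_add_card_filter_not
    (s := Finset.univ.filter fun c : Fin a.len => s ≤ (c : ℕ)) fun c => m ≤ (a.entry c : ℕ)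
  have hperm := Finset.card_filter_add_card_filter_not
    (s := Finset.univ.filter fun c => s ≤ (σ c : ℕ)) fun c => m ≤ (a.entry c : ℕ)
  simp only [Finset.filter_filter] at hid hperm
  omega

theorem eq_one_of_permExp_eq {σ : Equiv.Perm (Fin a.len)} (h : a.permExp σ = a.leadExp) :
    σ = 1 := by
  ext c
  have hcard := card_filter_eq_of_sum_rectExp_eq h ((σ c : ℕ), (a.entry c : ℕ))
  obtain ⟨d, hd⟩ := Finset.card_pos.1 (hcard ▸ Finset.card_pos.2 ⟨c, by simp⟩)
  obtain ⟨hσ, hcd⟩ := Prod.ext_iff.1 (Finset.mem_filter.1 hd).2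
  obtain rfl : d = c := a.entry_injective (Fin.ext hcd)
  exact hσ.symm

theorem coeff_plueckerCoord_rectMatrix (a : PBWColumn n) (d : ℕ × ℕ →₀ ℕ) :
    coeff d (plueckerCoord (rectMatrix R n) a) = ∑ σ : Equiv.Perm (Fin a.len),
      if (∀ c, (σ c : ℕ) ≤ a.entry c) ∧ a.permExp σ = d then
        ((Equiv.Perm.sign σ : ℤ) : R) else 0 := by
  classical
  rw [plueckerCoord, Matrix.det_apply', coeff_sum]
  refine Finset.sum_congr rfl fun σ _ => ?_
  have hprod : ∏ c, (rectMatrix R n).submatrix (Fin.castLE a.len_lt.le) a.entry (σ c) c =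
      if ∀ c, (σ c : ℕ) ≤ a.entry c then monomial (a.permExp σ) 1 else 0 := by
    simp only [rectMatrix, Matrix.submatrix_apply, Matrix.of_apply, Fin.le_def, Fin.val_castLE,
      permExp, monomial_sum_one, Finset.prod_ite_zero, Finset.mem_univ, true_implies]
  rw [hprod, ← map_intCast (C : R →+* MvPolynomial (ℕ × ℕ) R), coeff_C_mul, ite_and]
  split_ifs <;> simp_all

theorem leadExp_mem_lowerBounds (a : PBWColumn n) : a.leadExp ∈
    lowerBounds ((plueckerCoord (rectMatrix R n) a).support : Set (ℕ × ℕ →₀ ℕ)) := by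
  intro d hd
  rw [Finset.mem_coe, mem_support_iff, coeff_plueckerCoord_rectMatrix] at hd
  obtain ⟨σ, -, hσ⟩ := Finset.exists_ne_zero_of_sum_ne_zero hd
  obtain ⟨hσa, rfl⟩ := (ite_ne_right_iff.1 hσ).1
  exact leadExp_le_permExp hσa

theorem coeff_leadExp_plueckerCoord (a : PBWColumn n) :
    coeff a.leadExp (plueckerCoord (rectMatrix R n) a) = 1 := by
  rw [coeff_plueckerCoord_rectMatrix, Finset.sum_eq_single 1]
  · rw [if_pos ⟨a.le_entry, a.permExp_one⟩]
    simp
  · exact fun σ _ hσ => if_neg fun h => hσ (eq_one_of_permExp_eq h.2)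
  · exact fun h => (h (Finset.mem_univ _)).elim

theorem isLeast_leadExp [Nontrivial R] (a : PBWColumn n) :
    IsLeast ((plueckerCoord (rectMatrix R n) a).support : Set (ℕ × ℕ →₀ ℕ)) a.leadExp :=
  ⟨mem_support_iff.2 (by simp [coeff_leadExp_plueckerCoord]), a.leadExp_mem_lowerBounds⟩

/-! ### Leading exponents and the order on columns -/

theorem mem_support_leadExp {s m : ℕ} : (s, m) ∈ a.leadExp.support ↔ m < a.prof s := by
  rw [Finsupp.mem_support_iff, leadExp, sum_rectExp_apply, Finset.card_ne_zero,
    lt_prof_iff_exists_le]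
  simp [Finset.Nonempty]

theorem le_iff_support_leadExp_subset : a ≤ b ↔ a.leadExp.support ⊆ b.leadExp.support := by
  rw [le_iff_lt_prof]
  simp only [← mem_support_leadExp, Finset.subset_iff, Prod.forall]

theorem support_leadExp_injective :
    Function.Injective fun a : PBWColumn n => a.leadExp.support := fun _ _ h =>
  (le_iff_support_leadExp_subset.2 h.le).antisymm (le_iff_support_leadExp_subset.2 h.ge)

theorem leadExp_injective : Function.Injective (leadExp (n := n)) := fun _ _ h =>
  support_leadExp_injective (congrArg Finsupp.support h)

theorem leadExp_ne_zero (a : PBWColumn n) : a.leadExp ≠ 0 := by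
  rw [← Finsupp.support_nonempty_iff]
  exact ⟨(0, 0), mem_support_leadExp.2 (a.len_pos.trans (a.len_le_prof a.len_pos))⟩

theorem support_leadExp_add (hgh : g ≤ h) :
    (g.leadExp + h.leadExp).support = h.leadExp.support := by
  rw [Finsupp.support_add_eq_union, Finset.union_eq_right]
  exact le_iff_support_leadExp_subset.1 hgh

theorem injOn_leadExp_add : Set.InjOn
    (fun p : PBWColumn n × PBWColumn n => p.1.leadExp + p.2.leadExp) {p | p.1 ≤ p.2} := by
  rintro ⟨g, h⟩ hgh ⟨g', h'⟩ hgh' heq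
  obtain rfl : h = h' := support_leadExp_injective <| by
    simpa only [support_leadExp_add hgh, support_leadExp_add hgh'] using
      congrArg Finsupp.support heq
  exact congrArg (·, h) (leadExp_injective (add_right_cancel heq))

theorem sup_le_of_leadExp_add_le (hgh : g ≤ h)
    (hle : a.leadExp + b.leadExp ≤ g.leadExp + h.leadExp) : a ⊔ b ≤ h := by
  have hsub := support_leadExp_add hgh ▸ Finsupp.support_mono hle
  rw [Finsupp.support_add_eq_union] at hsub
  exact sup_le (le_iff_support_leadExp_subset.2 (Finset.subset_union_left.trans hsub))
    (le_iff_support_leadExp_subset.2 (Finset.subset_union_right.trans hsub))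

theorem eq_sup_of_leadExp_add_eq (hgh : g ≤ h)
    (heq : g.leadExp + h.leadExp = a.leadExp + b.leadExp) : h = a ⊔ b := by
  refine le_antisymm (le_iff_lt_prof.2 fun s m hm => ?_) (sup_le_of_leadExp_add_le hgh heq.ge)
  rw [← mem_support_leadExp, ← support_leadExp_add hgh, heq, Finsupp.support_add_eq_union,
    Finset.mem_union, mem_support_leadExp, mem_support_leadExp] at hm
  rwa [prof_sup, lt_max_iff]

end PBWColumn

/-! ### Ideals with quadratic straightening relations -/

section Straightening

open MvPolynomial

variable {Ω : Type*}

theorem X_mul_X_eq_monomial (a b : Ω) :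
    (X a * X b : MvPolynomial Ω ℂ) = monomial (Finsupp.single a 1 + Finsupp.single b 1) 1 := by
  rw [X, X, monomial_mul, one_mul]

theorem mk_monomial_one (I : Ideal (MvPolynomial Ω ℂ)) (d : Ω →₀ ℕ) :
    Ideal.Quotient.mk I (monomial d 1) = d.prod fun ω k => Ideal.Quotient.mk I (X ω) ^ k := by
  simp only [monomial_eq, C_1, one_mul, Finsupp.prod, map_prod, map_pow]

/-- The linear combination of the products `X p.1 * X p.2` with coefficients `c p`. Right-hand
sides of straightening relations are of this form. -/
noncomputable def quadForm : (Ω × Ω →₀ ℂ) →ₗ[ℂ] MvPolynomial Ω ℂ :=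
  Finsupp.linearCombination ℂ fun p => X p.1 * X p.2

theorem quadForm_apply (c : Ω × Ω →₀ ℂ) :
    quadForm c = ∑ p ∈ c.support, C (c p) * (X p.1 * X p.2) := by
  simp only [quadForm, Finsupp.linearCombination_apply, Finsupp.sum, C_mul']

theorem exists_embedding_fin_of_mem {α : Type*} {s : Finset α} {x : α} (hx : x ∈ s) :
    ∃ (m : ℕ) (f : Fin (m + 1) ↪ α), f 0 = x ∧ Finset.univ.map f = s := by
  classical
  obtain ⟨m, hm⟩ := Nat.exists_eq_add_one_of_ne_zero (Finset.card_ne_zero_of_mem hx)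
  let e : Fin (m + 1) ≃ s := (s.equivFinOfCardEq hm).symm
  refine ⟨m, ((Equiv.swap 0 (e.symm ⟨x, hx⟩)).trans e).toEmbedding.trans
    (Function.Embedding.subtype _), by simp, ?_⟩
  rw [← Finset.map_map, Finset.map_univ_equiv, Finset.univ_eq_attach]
  exact s.attach_map_val

theorem exists_quadForm_eq_sum_fin {c : Ω × Ω →₀ ℂ} {p : Ω × Ω} (hp : p ∈ c.support) :
    ∃ (m : ℕ) (f : Fin (m + 1) ↪ Ω × Ω), f 0 = p ∧ (∀ i, f i ∈ c.support) ∧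
      quadForm c = ∑ i, C (c (f i)) * (X (f i).1 * X (f i).2) := by
  obtain ⟨m, f, h0, hf⟩ := exists_embedding_fin_of_mem hp
  refine ⟨m, f, h0, fun i => ?_, ?_⟩
  · rw [← hf]
    exact Finset.mem_map_of_mem f (Finset.mem_univ i)
  · rw [quadForm_apply, ← hf, Finset.sum_map]

theorem exists_mem_support_of_mem_support_quadForm {c : Ω × Ω →₀ ℂ} {d : Ω →₀ ℕ}
    (hd : d ∈ (quadForm c).support) :
    ∃ p ∈ c.support, d = Finsupp.single p.1 1 + Finsupp.single p.2 1 := by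
  classical
  rw [quadForm_apply, mem_support_iff, coeff_sum] at hd
  obtain ⟨p, hp, hne⟩ := Finset.exists_ne_zero_of_sum_ne_zero hd
  rw [coeff_C_mul, X_mul_X_eq_monomial, coeff_monomial] at hne
  exact ⟨p, hp, (ite_ne_right_iff.1 (right_ne_zero_of_mul hne)).1.symm⟩

theorem eq_or_eq_of_mem_support_single_add_single {g h x : Ω}
    (hx : x ∈ (Finsupp.single g 1 + Finsupp.single h 1 : Ω →₀ ℕ).support) : x = g ∨ x = h := by
  classical
  exact (Finset.mem_union.1 (Finsupp.support_add hx)).imp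
    (fun hg => Finset.mem_singleton.1 (Finsupp.support_single_subset hg))
    fun hh => Finset.mem_singleton.1 (Finsupp.support_single_subset hh)

theorem eq_of_le_of_degree_le {d e : Ω →₀ ℕ} (hde : d ≤ e) (hdeg : e.degree ≤ d.degree) :
    d = e := by
  obtain ⟨f, rfl⟩ := exists_add_of_le hde
  rw [map_add, add_le_iff_nonpos_right, nonpos_iff_eq_zero, Finsupp.degree_eq_zero_iff] at hdeg
  rw [hdeg, add_zero]

variable [PartialOrder Ω]

namespace IsStandardMonomial

variable {d e : Ω →₀ ℕ}

theorem of_le (he : IsStandardMonomial e) (hde : d ≤ e) : IsStandardMonomial d :=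
  fun a ha b hb => he a (Finsupp.support_mono hde ha) b (Finsupp.support_mono hde hb)

theorem single (a : Ω) : IsStandardMonomial (Finsupp.single a 1) := by
  intro x hx y hy
  rw [Finset.mem_singleton.1 (Finsupp.support_single_subset hx),
    Finset.mem_singleton.1 (Finsupp.support_single_subset hy)]
  exact Or.inl le_rfl

theorem exists_isGreatest (hd : IsStandardMonomial d) (h0 : d ≠ 0) :
    ∃ a, IsGreatest (d.support : Set Ω) a := by
  obtain ⟨a, ha⟩ := d.support.exists_maximal (Finsupp.support_nonempty_iff.2 h0)
  exact ⟨a, ha.prop, fun b hb => (hd b hb a ha.prop).elim id fun hab => ha.le_of_ge hb hab⟩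

end IsStandardMonomial

theorem isStandardMonomial_single_add_single_iff {g h : Ω} :
    IsStandardMonomial (Finsupp.single g 1 + Finsupp.single h 1) ↔ g ≤ h ∨ h ≤ g := by
  refine ⟨fun hgh => hgh g (by simp) h (by simp), fun hgh x hx y hy => ?_⟩
  rcases eq_or_eq_of_mem_support_single_add_single hx with rfl | rfl <;>
    rcases eq_or_eq_of_mem_support_single_add_single hy with rfl | rfl <;>
    simp [hgh, hgh.symm]

theorem exists_eq_add_of_not_isStandardMonomial {d : Ω →₀ ℕ} (hd : ¬ IsStandardMonomial d) :
    ∃ (a b : Ω) (d' : Ω →₀ ℕ), ¬ a ≤ b ∧ ¬ b ≤ a ∧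
      d = d' + (Finsupp.single a 1 + Finsupp.single b 1) := by
  classical
  simp only [IsStandardMonomial, not_forall, not_or] at hd
  obtain ⟨a, ha, b, hb, hab, hba⟩ := hd
  have hne : a ≠ b := fun h => hab h.le
  refine ⟨a, b, d - (Finsupp.single a 1 + Finsupp.single b 1), hab, hba,
    (tsub_add_cancel_of_le fun x => ?_).symm⟩
  rw [Finsupp.mem_support_iff] at ha hb
  rw [Finsupp.add_apply, Finsupp.single_apply, Finsupp.single_apply]
  grind

/-- The space of linear combinations of standard monomials. -/
noncomputable def standardPolynomials (Ω : Type*) [PartialOrder Ω] :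
    Submodule ℂ (MvPolynomial Ω ℂ) :=
  restrictSupport ℂ {d | IsStandardMonomial d}

theorem quadForm_mem_standardPolynomials {c : Ω × Ω →₀ ℂ} (hc : ∀ p ∈ c.support, p.1 ≤ p.2) :
    quadForm c ∈ standardPolynomials Ω := by
  intro d hd
  obtain ⟨p, hp, rfl⟩ := exists_mem_support_of_mem_support_quadForm hd
  exact isStandardMonomial_single_add_single_iff.2 (Or.inl (hc p hp))

theorem exists_descending_weight (Ω : Type*) [PartialOrder Ω] [Finite Ω] :
    ∃ w : Ω → ℕ, ∀ a b g h, a < h → b < h → w g + w h < w a + w b := by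
  set r : Ω → ℕ := fun x => (Set.Iio x).ncard
  have hr_lt : StrictMono r := fun x y hxy => Set.ncard_lt_ncard (Set.Iio_ssubset_Iio hxy)
  have hr_le : ∀ x, r x ≤ Nat.card Ω := fun x => Set.ncard_le_card _
  refine ⟨fun x => 2 ^ Nat.card Ω - 2 ^ r x, fun a b g h hah hbh => ?_⟩
  have ha : 2 ^ (r a + 1) ≤ 2 ^ r h := Nat.pow_le_pow_right two_pos (hr_lt hah)
  have hb : 2 ^ (r b + 1) ≤ 2 ^ r h := Nat.pow_le_pow_right two_pos (hr_lt hbh)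
  have hg : 2 ^ r g ≤ 2 ^ Nat.card Ω := Nat.pow_le_pow_right two_pos (hr_le g)
  have hh : 2 ^ r h ≤ 2 ^ Nat.card Ω := Nat.pow_le_pow_right two_pos (hr_le h)
  have hpos : 0 < 2 ^ r g := by positivity
  rw [pow_succ] at ha hb
  dsimp only
  omega

theorem sup_standardPolynomials_eq_top [Finite Ω] {J : Ideal (MvPolynomial Ω ℂ)}
    (hJ : ∀ a b : Ω, ¬ a ≤ b → ¬ b ≤ a → ∃ c : Ω × Ω →₀ ℂ,
      (∀ p ∈ c.support, a < p.2 ∧ b < p.2) ∧ X a * X b - quadForm c ∈ J) :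
    J.restrictScalars ℂ ⊔ standardPolynomials Ω = ⊤ := by
  obtain ⟨w, hw⟩ := exists_descending_weight Ω
  set S := J.restrictScalars ℂ ⊔ standardPolynomials Ω
  suffices h : ∀ d : Ω →₀ ℕ, monomial d 1 ∈ S by
    rw [← top_le_iff, ← (basisMonomials Ω ℂ).span_eq, Submodule.span_le]
    rintro _ ⟨d, rfl⟩
    exact h d
  intro d
  induction hN : Finsupp.weight w d using Nat.strong_induction_on generalizing d with
  | _ N ih =>
    by_cases hd : IsStandardMonomial d
    · exact Submodule.mem_sup_right ((monomial_mem_restrictSupport ℂ).2 (Or.inl hd))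
    obtain ⟨a, b, d, hab, hba, rfl⟩ := exists_eq_add_of_not_isStandardMonomial hd
    obtain ⟨c, hc, hrel⟩ := hJ a b hab hba
    have hsplit : (monomial (d + (Finsupp.single a 1 + Finsupp.single b 1)) 1 :
        MvPolynomial Ω ℂ) =
        monomial d 1 * (X a * X b - quadForm c) + monomial d 1 * quadForm c := by
      rw [← mul_add, sub_add_cancel, X_mul_X_eq_monomial, monomial_mul, one_mul]
    rw [hsplit]
    refine S.add_mem (Submodule.mem_sup_left (J.mul_mem_left _ hrel)) ?_
    rw [quadForm_apply, Finset.mul_sum]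
    refine S.sum_mem fun p hp => ?_
    rw [mul_left_comm, X_mul_X_eq_monomial, monomial_mul, one_mul, C_mul']
    refine S.smul_mem _ (ih _ ?_ _ rfl)
    have hlt := hw a b p.1 p.2 (hc p hp).1 (hc p hp).2
    simp only [map_add, Finsupp.weight_single, one_smul] at hN ⊢
    omega

namespace IsStraighteningRelation

variable {I : Ideal (MvPolynomial Ω ℂ)} {a b : Ω} {p : MvPolynomial Ω ℂ} {d : Ω →₀ ℕ}

theorem coeff_eq (hp : IsStraighteningRelation I a b p) (hd : ¬ IsStandardMonomial d) :
    coeff d p = coeff d (X a * X b) := by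
  rw [← sub_eq_zero, ← coeff_sub, ← notMem_support_iff]
  exact fun h => hd (hp.2 d h)

theorem eq_of_mem_support (hp : IsStraighteningRelation I a b p) (hd : d ∈ p.support)
    (hstd : ¬ IsStandardMonomial d) : d = Finsupp.single a 1 + Finsupp.single b 1 := by
  classical
  rw [mem_support_iff, hp.coeff_eq hstd, X_mul_X_eq_monomial, coeff_monomial] at hd
  exact (ite_ne_right_iff.1 hd).1.symm

theorem mem_support (hp : IsStraighteningRelation I a b p)
    (hstd : ¬ IsStandardMonomial (Finsupp.single a 1 + Finsupp.single b 1)) :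
    Finsupp.single a 1 + Finsupp.single b 1 ∈ p.support := by
  classical
  simp [hp.coeff_eq hstd, X_mul_X_eq_monomial]

end IsStraighteningRelation

/-- The ideal `I` admits quadratic straightening: standard monomials are linearly independent
modulo `I`, and modulo `I` each product `X a * X b` with `a`, `b` incomparable is a linear
combination of products `X g * X h` with `g` below and `h` above both `a` and `b`. -/
structure HasQuadraticStraightening (I : Ideal (MvPolynomial Ω ℂ)) : Prop where
  disjoint : Disjoint (I.restrictScalars ℂ) (standardPolynomials Ω)
  exists_quadForm : ∀ a b : Ω, ¬ a ≤ b → ¬ b ≤ a → ∃ c : Ω × Ω →₀ ℂ,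
    (∀ p ∈ c.support, (p.1 ≤ a ∧ p.1 ≤ b) ∧ a ≤ p.2 ∧ b ≤ p.2) ∧ X a * X b - quadForm c ∈ I

/-- The set of all straightening relations modulo the ideal `I`. -/
def straighteningRelations (I : Ideal (MvPolynomial Ω ℂ)) : Set (MvPolynomial Ω ℂ) :=
  {p | ∃ a b : Ω, ¬ a ≤ b ∧ ¬ b ≤ a ∧ IsStraighteningRelation I a b p}

namespace HasQuadraticStraightening

variable {I : Ideal (MvPolynomial Ω ℂ)} {a b : Ω} {p q : MvPolynomial Ω ℂ}

theorem relation_unique (hI : HasQuadraticStraightening I) (hp : IsStraighteningRelation I a b p)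
    (hq : IsStraighteningRelation I a b q) : p = q := by
  refine sub_eq_zero.1 (Submodule.disjoint_def.1 hI.disjoint _ (I.sub_mem hp.1 hq.1) ?_)
  rw [← sub_sub_sub_cancel_right p q (X a * X b)]
  exact Submodule.sub_mem _ hp.2 hq.2

theorem exists_relation (hI : HasQuadraticStraightening I) (hab : ¬ a ≤ b) (hba : ¬ b ≤ a) :
    ∃ c : Ω × Ω →₀ ℂ, (∀ p ∈ c.support, (p.1 ≤ a ∧ p.1 ≤ b) ∧ a ≤ p.2 ∧ b ≤ p.2) ∧
      IsStraighteningRelation I a b (X a * X b - quadForm c) := by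
  obtain ⟨c, hc, hmem⟩ := hI.exists_quadForm a b hab hba
  refine ⟨c, hc, hmem, ?_⟩
  rw [sub_sub_cancel_left]
  exact (standardPolynomials Ω).neg_mem
    (quadForm_mem_standardPolynomials fun p hp => (hc p hp).1.1.trans (hc p hp).2.1)

theorem existsUnique_relation (hI : HasQuadraticStraightening I) (hab : ¬ a ≤ b)
    (hba : ¬ b ≤ a) : ∃! p, IsStraighteningRelation I a b p :=
  have ⟨_, _, hrel⟩ := hI.exists_relation hab hba
  ⟨_, hrel, fun _ hq => hI.relation_unique hq hrel⟩

theorem exists_eq_sub_quadForm (hI : HasQuadraticStraightening I) (hab : ¬ a ≤ b)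
    (hba : ¬ b ≤ a) (hp : IsStraighteningRelation I a b p) :
    ∃ c : Ω × Ω →₀ ℂ, (∀ p ∈ c.support, (p.1 ≤ a ∧ p.1 ≤ b) ∧ a ≤ p.2 ∧ b ≤ p.2) ∧
      p = X a * X b - quadForm c :=
  have ⟨c, hc, hrel⟩ := hI.exists_relation hab hba
  ⟨c, hc, hI.relation_unique hp hrel⟩

theorem span_sup_standardPolynomials [Finite Ω] (hI : HasQuadraticStraightening I) :
    (Ideal.span (straighteningRelations I)).restrictScalars ℂ ⊔ standardPolynomials Ω = ⊤ := by
  refine sup_standardPolynomials_eq_top fun a b hab hba => ?_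
  obtain ⟨c, hc, hrel⟩ := hI.exists_relation hab hba
  exact ⟨c, fun p hp => ⟨(hc p hp).2.1.lt_of_ne fun h => hba (h ▸ (hc p hp).2.2),
    (hc p hp).2.2.lt_of_ne fun h => hab (h ▸ (hc p hp).2.1)⟩,
    Ideal.subset_span ⟨a, b, hab, hba, hrel⟩⟩

theorem span_straighteningRelations [Finite Ω] (hI : HasQuadraticStraightening I) :
    Ideal.span (straighteningRelations I) = I := by
  have hle : Ideal.span (straighteningRelations I) ≤ I :=
    Ideal.span_le.2 fun _ ⟨_, _, _, _, h⟩ => h.1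
  refine hle.antisymm fun q hq => ?_
  obtain ⟨j, hj, s, hs, rfl⟩ := Submodule.mem_sup.1
    (hI.span_sup_standardPolynomials.ge (Submodule.mem_top (x := q)))
  have hs0 : s = 0 :=
    Submodule.disjoint_def.1 hI.disjoint s ((I.add_mem_iff_right (hle hj)).1 hq) hs
  rwa [hs0, add_zero]

theorem degree_of_mem_support (hI : HasQuadraticStraightening I)
    (hp : p ∈ straighteningRelations I) {d : Ω →₀ ℕ} (hd : d ∈ p.support) : d.degree = 2 := by
  classical
  obtain ⟨a, b, hab, hba, hrel⟩ := hp
  obtain ⟨c, -, rfl⟩ := hI.exists_eq_sub_quadForm hab hba hrel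
  rcases Finset.mem_union.1 (support_sub _ _ _ hd) with hd | hd
  · rw [X_mul_X_eq_monomial] at hd
    simp [Finset.mem_singleton.1 (support_monomial_subset hd)]
  · obtain ⟨g, -, rfl⟩ := exists_mem_support_of_mem_support_quadForm hd
    simp

theorem minimal_straighteningRelations [Finite Ω] (hI : HasQuadraticStraightening I) :
    Minimal (fun S : Set (MvPolynomial Ω ℂ) => Ideal.span S = I) (straighteningRelations I) := by
  refine ⟨hI.span_straighteningRelations, fun S hS hle e he => ?_⟩
  obtain ⟨a, b, hab, hba, hrel⟩ := id he
  by_contra heS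
  set m := Finsupp.single a 1 + Finsupp.single b 1 with hm
  have hm_std : ¬ IsStandardMonomial m := by
    rw [hm, isStandardMonomial_single_add_single_iff, not_or]
    exact ⟨hab, hba⟩
  have hupper : IsUpperSet {d | ¬ d ≤ m} := fun _ _ hle hd hd' => hd (hle.trans hd')
  have hspan : Ideal.span S ≤ restrictSupportIdeal ℂ {d | ¬ d ≤ m} hupper := by
    refine Ideal.span_le.2 fun s hs d hd hdm => heS ?_
    have hdm : d = m := eq_of_le_of_degree_le hdm
      ((by simp [hm] : m.degree = 2).trans (hI.degree_of_mem_support (hle hs) hd).symm).le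
    obtain ⟨a', b', -, -, hrel'⟩ := hle hs
    have hm' := hrel'.eq_of_mem_support hd (hdm ▸ hm_std)
    rw [hdm, hm, ← (monomial_left_injective (one_ne_zero (α := ℂ))).eq_iff,
      ← X_mul_X_eq_monomial, ← X_mul_X_eq_monomial] at hm'
    rwa [← hI.relation_unique (⟨hrel'.1, hm' ▸ hrel'.2⟩ : IsStraighteningRelation I a b s) hrel]
  exact hspan (hS.ge hrel.1) (hrel.mem_support hm_std) le_rfl

theorem linearIndependent_standard (hI : HasQuadraticStraightening I) : LinearIndependent ℂ
    fun d : {d : Ω →₀ ℕ // IsStandardMonomial d} => Ideal.Quotient.mk I (monomial d.1 1) := by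
  refine ((basisMonomials Ω ℂ).linearIndependent.comp _ Subtype.val_injective).map
    (f := (Ideal.Quotient.mkₐ ℂ I).toLinearMap) ?_
  convert hI.disjoint.symm using 1
  · rw [standardPolynomials, restrictSupport_eq_span, Set.image_eq_range]
    simp only [coe_basisMonomials]
    rfl
  · ext q
    exact Ideal.Quotient.eq_zero_iff_mem

theorem span_standard_eq_top [Finite Ω] (hI : HasQuadraticStraightening I) :
    Submodule.span ℂ (Set.range fun d : {d : Ω →₀ ℕ // IsStandardMonomial d} =>
      Ideal.Quotient.mk I (monomial d.1 1)) = ⊤ := by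
  let φ := (Ideal.Quotient.mkₐ ℂ I).toLinearMap
  have hφ : LinearMap.range φ = ⊤ := LinearMap.range_eq_top.2 Ideal.Quotient.mk_surjective
  have hker : (I.restrictScalars ℂ).map φ = ⊥ :=
    (Submodule.eq_bot_iff _).2 fun _ ⟨_, hq, h⟩ => h ▸ Ideal.Quotient.eq_zero_iff_mem.2 hq
  have hmap := congrArg (Submodule.map φ) hI.span_sup_standardPolynomials
  rw [hI.span_straighteningRelations, Submodule.map_sup, hker, bot_sup_eq, Submodule.map_top, hφ,
    standardPolynomials, restrictSupport_eq_span, Submodule.map_span, Set.image_image,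
    Set.image_eq_range] at hmap
  exact hmap

theorem exists_isLeast_of_mem_support (hI : HasQuadraticStraightening I) (hab : ¬ a ≤ b)
    (hba : ¬ b ≤ a) {c : {d : Ω →₀ ℕ // IsStandardMonomial d} →₀ ℂ}
    (hc : Ideal.Quotient.mk I (X a) * Ideal.Quotient.mk I (X b) =
      c.sum fun d x => x • Ideal.Quotient.mk I (monomial d.1 1))
    {d : {d : Ω →₀ ℕ // IsStandardMonomial d}} (hd : d ∈ c.support) :
    ∃ ω, IsLeast (d.1.support : Set Ω) ω ∧ ω ≤ a ∧ ω ≤ b := by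
  classical
  set q : MvPolynomial Ω ℂ := c.sum fun d x => monomial d.1 x with hq
  have hq_std : q ∈ standardPolynomials Ω := Submodule.sum_mem _ fun d _ =>
    (monomial_mem_restrictSupport ℂ).2 (Or.inl d.2)
  have hq_mk : Ideal.Quotient.mk I q = Ideal.Quotient.mk I (X a * X b) := by
    rw [map_mul, hc, hq, Finsupp.sum, Finsupp.sum, map_sum]
    refine Finset.sum_congr rfl fun d _ => ?_
    rw [← mul_one (c d), ← smul_eq_mul, ← smul_monomial, smul_eq_mul, mul_one]
    rfl
  have hrel : IsStraighteningRelation I a b (X a * X b - q) :=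
    ⟨Ideal.Quotient.eq.1 hq_mk.symm,
      by rw [sub_sub_cancel_left]; exact (standardPolynomials Ω).neg_mem hq_std⟩
  obtain ⟨c', hc', heq⟩ := hI.exists_eq_sub_quadForm hab hba hrel
  have hd_mem : d.1 ∈ (quadForm c').support := by
    rw [← sub_right_inj.1 heq, mem_support_iff, hq, Finsupp.sum, coeff_sum]
    simpa [coeff_monomial, Subtype.val_inj] using hd
  obtain ⟨⟨g, h⟩, hp, hdp⟩ := exists_mem_support_of_mem_support_quadForm hd_mem
  obtain ⟨⟨hga, hgb⟩, hah, -⟩ := hc' _ hp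
  rw [hdp]
  refine ⟨g, ⟨by simp, fun x hx => ?_⟩, hga, hgb⟩
  rcases eq_or_eq_of_mem_support_single_add_single hx with rfl | rfl
  exacts [le_rfl, hga.trans hah]

theorem isASL [Finite Ω] (hI : HasQuadraticStraightening I) :
    IsASL fun ω => Ideal.Quotient.mk I (X ω) := by
  have hli := hI.linearIndependent_standard
  refine ⟨fun a b hab => ?_, by simpa only [mk_monomial_one] using hli,
    by simpa only [mk_monomial_one] using hI.span_standard_eq_top,
    fun a b hab hba c hc d hd => ?_⟩
  · exact Finsupp.single_left_injective one_ne_zero <| Subtype.ext_iff.1 <|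
      hli.injective (a₁ := ⟨_, .single a⟩) (a₂ := ⟨_, .single b⟩) hab
  · simp only [← mk_monomial_one] at hc
    obtain ⟨ω, hω, hle⟩ := hI.exists_isLeast_of_mem_support hab hba hc hd
    exact ⟨ω, hω.1, fun _ h => hω.2 h, hle⟩

end HasQuadraticStraightening

end Straightening

/-! ### Relations between Plücker coordinates -/

open MvPolynomial in
theorem aeval_plueckerCoord_eq_zero {A : Type*} [CommRing A] [Algebra ℂ A] {n : ℕ}
    (z : Matrix (Fin n) (Fin n) A) {p : PlueckerRing n} (hp : p ∈ plueckerIdeal n) :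
    aeval (plueckerCoord z) p = 0 := by
  have hz : aeval (plueckerCoord z) = (aeval (R := ℂ) fun ij : Fin n × Fin n => z ij.1 ij.2).comp
      (aeval (R := ℂ) (plueckerCoord (Matrix.mvPolynomialX (Fin n) (Fin n) ℂ))) := by
    refine MvPolynomial.algHom_ext fun b => ?_
    rw [AlgHom.comp_apply, aeval_X, aeval_X, plueckerCoord, plueckerCoord, AlgHom.map_det]
    congr 1
    ext i j
    simp [Matrix.mvPolynomialX]
  have hp' : aeval (R := ℂ) (plueckerCoord (Matrix.mvPolynomialX (Fin n) (Fin n) ℂ)) p = 0 := hp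
  rw [hz, AlgHom.comp_apply, hp', map_zero]

namespace PBWColumn

open MvPolynomial

variable {n : ℕ} {a b : PBWColumn n}

theorem support_linearCombination_leadExp {d : PBWColumn n →₀ ℕ}
    (ha : IsGreatest (d.support : Set (PBWColumn n)) a) :
    (Finsupp.linearCombination ℕ leadExp d).support = a.leadExp.support := by
  ext p
  have hsum : Finsupp.linearCombination ℕ leadExp d p = ∑ b ∈ d.support, d b * b.leadExp p := by
    simp [Finsupp.linearCombination_apply, Finsupp.sum, Finsupp.finsetSum_apply]
  rw [Finsupp.mem_support_iff, hsum, Ne, Finset.sum_eq_zero_iff, Finsupp.mem_support_iff]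
  refine ⟨fun h hp => h fun b hb => ?_, fun hp h => ?_⟩
  · rw [← Finsupp.notMem_support_iff] at hp
    rw [Finsupp.notMem_support_iff.1 fun hpb =>
      hp (le_iff_support_leadExp_subset.1 (ha.2 hb) hpb), mul_zero]
  · exact mul_ne_zero (Finsupp.mem_support_iff.1 ha.1) hp (h a ha.1)

theorem linearCombination_leadExp_eq_zero {d : PBWColumn n →₀ ℕ} (hd : IsStandardMonomial d)
    (h : Finsupp.linearCombination ℕ leadExp d = 0) : d = 0 := by
  by_contra h0
  obtain ⟨a, ha⟩ := hd.exists_isGreatest h0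
  have hsupp := support_linearCombination_leadExp ha
  rw [h, Finsupp.support_zero, eq_comm, Finsupp.support_eq_empty] at hsupp
  exact a.leadExp_ne_zero hsupp

theorem injOn_linearCombination_leadExp :
    Set.InjOn (Finsupp.linearCombination ℕ (leadExp (n := n))) {d | IsStandardMonomial d} := by
  intro d hd e he h
  induction hN : d.degree generalizing d e with
  | zero =>
    obtain rfl := (Finsupp.degree_eq_zero_iff d).1 hN
    exact (linearCombination_leadExp_eq_zero he (by simpa using h.symm)).symm
  | succ N ih =>
    have hd0 : d ≠ 0 := by rintro rfl; simp at hN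
    have he0 : e ≠ 0 := by
      rintro rfl
      exact hd0 (linearCombination_leadExp_eq_zero hd (by simpa using h))
    obtain ⟨a, ha⟩ := IsStandardMonomial.exists_isGreatest hd hd0
    obtain ⟨b, hb⟩ := IsStandardMonomial.exists_isGreatest he he0
    obtain rfl : a = b := support_leadExp_injective <| by
      simpa only [support_linearCombination_leadExp ha, support_linearCombination_leadExp hb] using
        congrArg Finsupp.support h
    have hsplit : ∀ f : PBWColumn n →₀ ℕ, a ∈ f.support →
        f - Finsupp.single a 1 + Finsupp.single a 1 = f := fun f hf =>
      tsub_add_cancel_of_le (Finsupp.single_le_iff.2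
        (Nat.one_le_iff_ne_zero.2 (Finsupp.mem_support_iff.1 hf)))
    rw [← hsplit d ha.1, ← hsplit e hb.1, map_add, map_add] at h
    rw [← hsplit d ha.1, map_add, Finsupp.degree_single, add_left_inj] at hN
    rw [← hsplit d ha.1, ← hsplit e hb.1, ih (IsStandardMonomial.of_le hd tsub_le_self)
      (IsStandardMonomial.of_le he tsub_le_self) (add_right_cancel h) hN]

theorem disjoint_plueckerIdeal_standardPolynomials (n : ℕ) :
    Disjoint ((plueckerIdeal n).restrictScalars ℂ) (standardPolynomials (PBWColumn n)) := by
  refine Submodule.disjoint_def.2 fun q hq hstd => ?_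
  exact eq_zero_of_aeval_eq_zero isLeast_leadExp (injOn_linearCombination_leadExp.mono hstd)
    (aeval_plueckerCoord_eq_zero _ hq)

theorem exists_quadForm_sub_mem_plueckerIdeal (a b : PBWColumn n) :
    ∃ c : PBWColumn n × PBWColumn n →₀ ℂ,
      (∀ p ∈ c.support, p.1 ≤ p.2 ∧
        p.1.entries.val + p.2.entries.val = a.entries.val + b.entries.val) ∧
      X a * X b - quadForm c ∈ plueckerIdeal n := by
  set Z := Matrix.mvPolynomialX (Fin n) (Fin n) ℂ
  obtain ⟨c, hc, hsum⟩ := Finsupp.mem_span_image_iff_linearCombination ℂ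
    (v := fun p : PBWColumn n × PBWColumn n => plueckerCoord Z p.1 * plueckerCoord Z p.2)
    (s := {p | p.1 ≤ p.2 ∧ p.1.entries.val + p.2.entries.val = a.entries.val + b.entries.val})
    (x := plueckerCoord Z a * plueckerCoord Z b) |>.1 (by
      refine Submodule.span_mono ?_ (plueckerCoord_mul_mem_span_standard (𝕜 := ℂ) Z a b)
      rintro _ ⟨g, h, hgh, hcont, rfl⟩
      exact ⟨(g, h), ⟨hgh, hcont⟩, rfl⟩)
  refine ⟨c, fun p hp => hc hp, ?_⟩
  change aeval (R := ℂ) (plueckerCoord Z) (X a * X b - quadForm c) = 0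
  rw [map_sub, sub_eq_zero, map_mul, aeval_X, aeval_X, ← hsum, quadForm_apply, map_sum]
  simp only [Finsupp.linearCombination_apply, Finsupp.sum, map_mul, aeval_X, aeval_C,
    Algebra.smul_def]

end PBWColumn

/-! ### Leading exponents of straightening relations -/

section LeadingExponents

open MvPolynomial

variable {Ω σ : Type*} {a b : Ω} {c : Ω × Ω →₀ ℂ}

theorem linearCombination_eq_mul_of_aeval_eq_zero {A : Type*} [CommRing A] [Algebra ℂ A]
    {F : Ω → A} (h : aeval F (X a * X b - quadForm c) = 0) :
    Finsupp.linearCombination ℂ (fun p : Ω × Ω => F p.1 * F p.2) c = F a * F b := by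
  rw [map_sub, sub_eq_zero, map_mul, aeval_X, aeval_X, quadForm_apply, map_sum] at h
  simp only [map_mul, aeval_C, aeval_X, ← Algebra.smul_def] at h
  exact h.symm

variable {F : Ω → MvPolynomial σ ℂ} {E : Ω → σ →₀ ℕ}

theorem add_le_add_of_aeval_eq_zero (hF : ∀ i, IsLeast ((F i).support : Set (σ →₀ ℕ)) (E i))
    (hE : Set.InjOn (fun p : Ω × Ω => E p.1 + E p.2) c.support)
    (h : aeval F (X a * X b - quadForm c) = 0) {p : Ω × Ω} (hp : p ∈ c.support) :
    E a + E b ≤ E p.1 + E p.2 :=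
  le_of_isLeast_support_linearCombination (fun p => isLeast_support_mul (hF p.1) (hF p.2)) hE
    (linearCombination_eq_mul_of_aeval_eq_zero h ▸ isLeast_support_mul (hF a) (hF b)) hp

theorem exists_add_eq_add_of_aeval_eq_zero
    (hF : ∀ i, IsLeast ((F i).support : Set (σ →₀ ℕ)) (E i))
    (hF_one : ∀ i, coeff (E i) (F i) = 1)
    (hE : Set.InjOn (fun p : Ω × Ω => E p.1 + E p.2) c.support)
    (h : aeval F (X a * X b - quadForm c) = 0) :
    ∃ p ∈ c.support, E p.1 + E p.2 = E a + E b ∧ c p = 1 := by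
  have hmul : ∀ i j, coeff (E i + E j) (F i * F j) = 1 := fun i j => by
    rw [coeff_add_mul_of_mem_lowerBounds (hF i).2 (hF j).2, hF_one, hF_one, one_mul]
  have hcomb := linearCombination_eq_mul_of_aeval_eq_zero h
  obtain ⟨p, hp, hpE, hcp⟩ := exists_eq_of_isLeast_support_linearCombination
    (fun p : Ω × Ω => isLeast_support_mul (hF p.1) (hF p.2)) hE
    (hcomb ▸ isLeast_support_mul (hF a) (hF b))
  refine ⟨p, hp, hpE, ?_⟩
  rwa [hcomb, hmul, ← hpE, hmul, mul_one] at hcp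

end LeadingExponents

namespace PBWColumn

open MvPolynomial

variable {n : ℕ} {a b : PBWColumn n} {c : PBWColumn n × PBWColumn n →₀ ℂ}

theorem sup_le_of_mem_support (hc : ∀ p ∈ c.support, p.1 ≤ p.2)
    (hrel : X a * X b - quadForm c ∈ plueckerIdeal n) {p : PBWColumn n × PBWColumn n}
    (hp : p ∈ c.support) : a ⊔ b ≤ p.2 :=
  sup_le_of_leadExp_add_le (hc p hp) <| add_le_add_of_aeval_eq_zero isLeast_leadExp
    (injOn_leadExp_add.mono hc) (aeval_plueckerCoord_eq_zero (rectMatrix ℂ n) hrel) hp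

theorem exists_leadExp_add_eq (hc : ∀ p ∈ c.support, p.1 ≤ p.2)
    (hrel : X a * X b - quadForm c ∈ plueckerIdeal n) :
    ∃ p ∈ c.support, p.1.leadExp + p.2.leadExp = a.leadExp + b.leadExp ∧ c p = 1 :=
  exists_add_eq_add_of_aeval_eq_zero isLeast_leadExp coeff_leadExp_plueckerCoord
    (injOn_leadExp_add.mono hc) (aeval_plueckerCoord_eq_zero (rectMatrix ℂ n) hrel)

end PBWColumn

/-! ### Complementary minors and the dual column -/

theorem exists_equiv_eq_sumElim {m l N : Type*} [Fintype m] [Fintype l] [Fintype N]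
    {f : m → N} {g : l → N} (hf : f.Injective) (hg : g.Injective) (hfg : ∀ i j, f i ≠ g j)
    (hcard : Fintype.card m + Fintype.card l = Fintype.card N) :
    ∃ e : m ⊕ l ≃ N, ⇑e = Sum.elim f g :=
  ⟨Equiv.ofBijective (Sum.elim f g) ((Fintype.bijective_iff_injective_and_card _).2
    ⟨hf.sumElim hg hfg, by rw [Fintype.card_sum, hcard]⟩), rfl⟩

section ComplementaryMinors

variable {m l N R : Type*} [Fintype m] [DecidableEq m] [Fintype l] [DecidableEq l] [Fintype N]
  [DecidableEq N] [CommRing R]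

theorem det_toBlocks₁₁_eq_of_mul_eq_one {G H : Matrix (m ⊕ l) (m ⊕ l) R} (h : G * H = 1) :
    G.toBlocks₁₁.det = G.det * H.toBlocks₂₂.det := by
  have hblocks : Matrix.fromBlocks G.toBlocks₁₁ G.toBlocks₁₂ G.toBlocks₂₁ G.toBlocks₂₂ *
      Matrix.fromBlocks H.toBlocks₁₁ H.toBlocks₁₂ H.toBlocks₂₁ H.toBlocks₂₂ =
      Matrix.fromBlocks 1 0 0 1 := by
    rw [Matrix.fromBlocks_toBlocks, Matrix.fromBlocks_toBlocks, h, Matrix.fromBlocks_one]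
  rw [Matrix.fromBlocks_multiply, Matrix.fromBlocks_inj] at hblocks
  have hmul : G * Matrix.fromBlocks 1 H.toBlocks₁₂ 0 H.toBlocks₂₂ =
      Matrix.fromBlocks G.toBlocks₁₁ 0 G.toBlocks₂₁ 1 := by
    conv_lhs => rw [← Matrix.fromBlocks_toBlocks G]
    rw [Matrix.fromBlocks_multiply, hblocks.2.1, hblocks.2.2.2]
    simp
  have hdet := congrArg Matrix.det hmul
  rw [Matrix.det_mul, Matrix.det_fromBlocks_zero₂₁, Matrix.det_fromBlocks_zero₁₂, Matrix.det_one,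
    Matrix.det_one, one_mul, mul_one] at hdet
  exact hdet.symm

theorem det_submatrix_inl_eq_sign_mul (g : Matrix N N R) (hg : IsUnit g.det) (f e : m ⊕ l ≃ N) :
    (g.submatrix (f ∘ Sum.inl) (e ∘ Sum.inl)).det = Equiv.Perm.sign (f.symm.trans e) *
      (g.det * (g⁻¹.submatrix (e ∘ Sum.inr) (f ∘ Sum.inr)).det) := by
  have hmul : g.submatrix f e * g⁻¹.submatrix e f = 1 := by
    rw [Matrix.submatrix_mul_equiv, Matrix.mul_nonsing_inv g hg, Matrix.submatrix_one_equiv]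
  have hdet : (g.submatrix f e).det = Equiv.Perm.sign (f.symm.trans e) * g.det := by
    rw [← Matrix.det_permute', ← Matrix.det_submatrix_equiv_self f]
    congr 1
    ext i j
    simp
  rw [← mul_assoc, ← hdet]
  exact det_toBlocks₁₁_eq_of_mul_eq_one hmul

end ComplementaryMinors

section DualLetter

variable {n : ℕ}

/-- The relabelling of letters in the duality of columns: it fixes the last letter and reverses
the order of the others. -/
def dualLetter (x : Fin n) : Fin n := if h : (x : ℕ) + 1 < n then ⟨n - 2 - x, by omega⟩ else x

theorem val_dualLetter (x : Fin n) :
    (dualLetter x : ℕ) = if (x : ℕ) + 1 < n then n - 2 - x else x := by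
  unfold dualLetter
  split_ifs <;> rfl

theorem dualLetter_injective : Function.Injective (dualLetter (n := n)) := by
  intro x y h
  rw [Fin.ext_iff, val_dualLetter, val_dualLetter] at h
  rw [Fin.ext_iff]
  split_ifs at h <;> omega

theorem dualLetter_mem_Ico_iff {s m : ℕ} (hm : m < n) (x : Fin n) :
    s ≤ (dualLetter x : ℕ) ∧ (dualLetter x : ℕ) < m ↔
      n - 1 - m ≤ (x : ℕ) ∧ (x : ℕ) < n - 1 - s := by
  rw [val_dualLetter]
  split_ifs <;> omega

end DualLetter

namespace PBWColumn

variable {n : ℕ} {a b : PBWColumn n}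

theorem exists_entries_eq_compl_image_dualLetter (a : PBWColumn n) :
    ∃ b : PBWColumn n, b.entries = (a.entries.image dualLetter)ᶜ := by
  have hpos := a.len_pos
  have hlt := a.len_lt
  have hcard : (a.entries.image dualLetter)ᶜ.card = n - a.len := by
    rw [Finset.card_compl, Finset.card_image_of_injective _ dualLetter_injective, card_entries,
      Fintype.card_fin]
  exact exists_entries_eq (Finset.card_pos.1 (by omega)) (by omega)

/-- The dual column, with the complementary letters up to relabelling. Plücker coordinates with
dual indices are complementary minors of each other. -/
noncomputable def dual (a : PBWColumn n) : PBWColumn n :=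
  a.exists_entries_eq_compl_image_dualLetter.choose

theorem entries_dual (a : PBWColumn n) : a.dual.entries = (a.entries.image dualLetter)ᶜ :=
  a.exists_entries_eq_compl_image_dualLetter.choose_spec

theorem len_dual_add_len (a : PBWColumn n) : a.dual.len + a.len = n := by
  rw [← card_entries a.dual, entries_dual, ← card_entries a,
    ← Finset.card_image_of_injective a.entries dualLetter_injective, Finset.card_compl_add_card,
    Fintype.card_fin]

theorem card_entries_dual_filter_add (a : PBWColumn n) {s m : ℕ} (hm : m < n) :
    (a.dual.entries.filter fun x : Fin n => s ≤ (x : ℕ) ∧ (x : ℕ) < m).card +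
      (a.entries.filter fun x : Fin n => n - 1 - m ≤ (x : ℕ) ∧ (x : ℕ) < n - 1 - s).card =
        m - s := by
  have himage : ((a.entries.image dualLetter).filter fun x : Fin n => s ≤ (x : ℕ) ∧ (x : ℕ) < m) =
      (a.entries.filter fun x : Fin n => n - 1 - m ≤ (x : ℕ) ∧ (x : ℕ) < n - 1 - s).image
        dualLetter := by
    simp only [Finset.filter_image, dualLetter_mem_Ico_iff hm]
  have hIco : (Finset.univ.filter fun x : Fin n => s ≤ (x : ℕ) ∧ (x : ℕ) < m).card = m - s := by
    rw [← Nat.card_Ico, ← Finset.card_map Fin.valEmbedding]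
    congr 1
    ext x
    simp only [Finset.mem_map, Finset.mem_filter, Finset.mem_univ, true_and, Finset.mem_Ico,
      Fin.valEmbedding_apply]
    exact ⟨by rintro ⟨c, hc, rfl⟩; exact hc, fun h => ⟨⟨x, h.2.trans hm⟩, h, rfl⟩⟩
  rw [← Finset.card_image_of_injective (a.entries.filter _) dualLetter_injective, ← himage,
    entries_dual, ← Finset.card_union_of_disjoint
      (Finset.disjoint_filter_filter disjoint_compl_left), ← Finset.filter_union,
    Finset.union_comm, Finset.union_compl, hIco]

theorem lt_prof_dual_iff (a : PBWColumn n) {s m : ℕ} (hsm : s ≤ m) (hm : m < n) :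
    m < a.dual.prof s ↔ ¬ n - 1 - s < a.prof (n - 1 - m) := by
  have hlen := a.len_dual_add_len
  have hcard := a.card_entries_dual_filter_add (s := s) hm
  rw [lt_prof_iff_card, lt_prof_iff_card]
  omega

theorem le_iff_lt_prof_of_le : a ≤ b ↔ ∀ s m, s ≤ m → m < n → m < a.prof s → m < b.prof s := by
  rw [le_iff_lt_prof]
  refine ⟨fun h s m _ _ => h s m, fun h s m hm => ?_⟩
  rcases le_total s m with hsm | hsm
  · exact h s m hsm (hm.trans_le (a.prof_le s)) hm
  · have hs : s < a.len := lt_of_not_ge fun hs => by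
      rw [a.prof_eq_zero hs] at hm
      exact Nat.not_lt_zero _ hm
    exact hsm.trans_lt (h s s le_rfl (hs.trans a.len_lt) (hs.trans_le (a.len_le_prof hs)))

theorem dual_le_dual_iff : b.dual ≤ a.dual ↔ a ≤ b := by
  rw [le_iff_lt_prof_of_le, le_iff_lt_prof_of_le]
  refine ⟨fun h s m hsm hm hlt => ?_, fun h s m hsm hm hlt => ?_⟩
  · have hdual := h (n - 1 - m) (n - 1 - s) (by omega) (by omega)
    rw [lt_prof_dual_iff b (by omega) (by omega), lt_prof_dual_iff a (by omega) (by omega),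
      show n - 1 - (n - 1 - m) = m by omega, show n - 1 - (n - 1 - s) = s by omega] at hdual
    exact not_imp_not.1 hdual hlt
  · rw [lt_prof_dual_iff _ hsm hm] at hlt ⊢
    exact fun hc => hlt (h _ _ (by omega) (by omega) hc)

theorem dual_injective : Function.Injective (dual (n := n)) := fun _ _ h =>
  le_antisymm (dual_le_dual_iff.1 h.ge) (dual_le_dual_iff.1 h.le)

section Coordinates

variable {A : Type*} [CommRing A]

/-- The matrix whose Plücker coordinates are, up to sign, those of `g` with dual indices: the
inverse of `g`, transposed and rearranged. The factor `g.det` that turns minors of the inverse into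
complementary minors of `g` is put into the row `0`, which every Plücker coordinate involves. -/
noncomputable def dualMatrix (g : Matrix (Fin n) (Fin n) A) : Matrix (Fin n) (Fin n) A :=
  Matrix.of fun i x => (if (i : ℕ) = 0 then g.det else 1) * g⁻¹ (dualLetter x) i.rev

theorem plueckerCoord_dualMatrix (g : Matrix (Fin n) (Fin n) A) (a : PBWColumn n) :
    plueckerCoord (dualMatrix g) a = g.det * (g⁻¹.submatrix (dualLetter ∘ a.entry)
      (Fin.rev ∘ Fin.castLE a.len_lt.le)).det := by
  have hprod : ∏ i : Fin a.len, (if (i : ℕ) = 0 then g.det else 1) = g.det := by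
    rw [Finset.prod_eq_single ⟨0, a.len_pos⟩ (fun i _ hi => if_neg fun h => hi (Fin.ext h))
      (fun h => (h (Finset.mem_univ _)).elim), if_pos rfl]
  rw [← Matrix.det_transpose (g⁻¹.submatrix _ _), ← hprod, ← Matrix.det_mul_column]
  rfl

theorem exists_plueckerCoord_dual_eq_units_smul (a : PBWColumn n) :
    ∃ ε : ℤˣ, ∀ g : Matrix (Fin n) (Fin n) A, IsUnit g.det →
      plueckerCoord g a.dual = ε • plueckerCoord (dualMatrix g) a := by
  have hlen := a.len_dual_add_len
  obtain ⟨f, hf⟩ := exists_equiv_eq_sumElim (Fin.castLE_injective a.dual.len_lt.le)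
    (Fin.rev_injective.comp (Fin.castLE_injective a.len_lt.le))
    (fun i j h => by
      have := congrArg Fin.val h
      simp only [Function.comp_apply, Fin.val_castLE, Fin.val_rev] at this
      omega)
    (by simp only [Fintype.card_fin, hlen])
  obtain ⟨e, he⟩ := exists_equiv_eq_sumElim a.dual.entry_injective
    (dualLetter_injective.comp a.entry_injective)
    (fun i j h => by
      have hi := a.dual.entry_mem_entries i
      rw [entries_dual, Finset.mem_compl, h] at hi
      exact hi (Finset.mem_image_of_mem _ (a.entry_mem_entries j)))
    (by simp only [Fintype.card_fin, hlen])
  refine ⟨Equiv.Perm.sign (f.symm.trans e), fun g hg => ?_⟩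
  have hminor := det_submatrix_inl_eq_sign_mul g hg f e
  rw [hf, he] at hminor
  simp only [Sum.elim_comp_inl, Sum.elim_comp_inr] at hminor
  rw [plueckerCoord_dualMatrix, Units.smul_def, zsmul_eq_mul]
  exact hminor

end Coordinates

open MvPolynomial

theorem exists_aeval_units_smul_X_dual_mem_plueckerIdeal (n : ℕ) :
    ∃ ε : PBWColumn n → ℤˣ, ∀ q ∈ plueckerIdeal n,
      aeval (R := ℂ) (fun a => ε a • X a.dual) q ∈ plueckerIdeal n := by
  choose ε hε using exists_plueckerCoord_dual_eq_units_smul (n := n) (A := ℂ)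
  refine ⟨ε, fun q hq => mem_plueckerIdeal_iff.2 fun g hg => ?_⟩
  have hcomp : (aeval (plueckerCoord g)).comp (aeval (R := ℂ) fun a => ε a • X a.dual) =
      aeval (R := ℂ) (plueckerCoord (dualMatrix g)) := by
    refine MvPolynomial.algHom_ext fun a => ?_
    rw [AlgHom.comp_apply, aeval_X, aeval_X, Units.smul_def, map_zsmul, aeval_X, hε a g hg,
      Units.smul_def, smul_smul, ← Units.val_mul, Int.units_mul_self, Units.val_one, one_smul]
  have hzero := aeval_plueckerCoord_eq_zero (dualMatrix g) hq
  rwa [← hcomp, AlgHom.comp_apply] at hzero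

theorem le_inf_of_mem_support {c : PBWColumn n × PBWColumn n →₀ ℂ}
    (hc : ∀ p ∈ c.support, p.1 ≤ p.2) (hrel : X a * X b - quadForm c ∈ plueckerIdeal n)
    {p : PBWColumn n × PBWColumn n} (hp : p ∈ c.support) : p.1 ≤ a ⊓ b := by
  obtain ⟨ε, hε⟩ := exists_aeval_units_smul_X_dual_mem_plueckerIdeal n
  have hzero : aeval (fun a => ε a • plueckerCoord (rectMatrix ℂ n) a.dual)
      (X a * X b - quadForm c) = 0 := by
    have h := aeval_plueckerCoord_eq_zero (rectMatrix ℂ n) (hε _ hrel)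
    rw [← AlgHom.comp_apply, comp_aeval] at h
    simpa only [Units.smul_def, map_zsmul, aeval_X] using h
  have hF : ∀ a : PBWColumn n, IsLeast
      ((ε a • plueckerCoord (rectMatrix ℂ n) a.dual).support : Set (ℕ × ℕ →₀ ℕ))
      a.dual.leadExp := fun a => by
    rcases Int.units_eq_one_or (ε a) with h | h
    · simpa only [h, one_smul] using isLeast_leadExp a.dual
    · simpa only [h, Units.neg_smul, one_smul, support_neg] using isLeast_leadExp a.dual
  have hinj : Set.InjOn (fun p : PBWColumn n × PBWColumn n =>
      p.1.dual.leadExp + p.2.dual.leadExp) c.support := fun p hp q hq h => by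
    have heq := injOn_leadExp_add (x₁ := (p.2.dual, p.1.dual)) (x₂ := (q.2.dual, q.1.dual))
      (dual_le_dual_iff.2 (hc p hp)) (dual_le_dual_iff.2 (hc q hq))
      ((add_comm _ _).trans (h.trans (add_comm _ _)))
    rw [Prod.mk.injEq] at heq
    exact Prod.ext (dual_injective heq.2) (dual_injective heq.1)
  have hle := add_le_add_of_aeval_eq_zero hF hinj hzero hp
  rw [add_comm p.1.dual.leadExp] at hle
  have hsup := sup_le_of_leadExp_add_le (dual_le_dual_iff.2 (hc p hp)) hle
  exact le_inf (dual_le_dual_iff.1 (le_sup_left.trans hsup))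
    (dual_le_dual_iff.1 (le_sup_right.trans hsup))

end PBWColumn

/-! ### Join-irreducible columns and the operation `⊙` -/

theorem irredIdeal_sup {L : Type*} [DistribLattice L] (a b : L) :
    irredIdeal (a ⊔ b) = irredIdeal a ∪ irredIdeal b := by
  ext p
  simp only [irredIdeal, Set.mem_union, Set.mem_ofPred_eq, ← and_or_left]
  exact and_congr_right fun hp => (supPrime_iff_supIrred.2 hp).le_sup

namespace PBWColumn

variable {n : ℕ} {p q a b g h : PBWColumn n} {s m s' m' : ℕ}

theorem lt_len_iff_prof_pos : s < a.len ↔ 0 < a.prof s :=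
  ⟨fun h => lt_of_lt_of_le a.len_pos (a.len_le_prof h), fun h => lt_of_not_ge fun hs =>
    h.ne' (a.prof_eq_zero hs)⟩

theorem exists_entry_eq_iff (hsm : s < m) :
    (∃ c : Fin a.len, (c : ℕ) = s ∧ (a.entry c : ℕ) = m) ↔
      a.prof s = m + 1 ∧ a.prof (s + 1) ≤ m := by
  constructor
  · rintro ⟨c, rfl, rfl⟩
    have hlen : a.len ≤ a.entry c := le_of_not_gt fun hc => hsm.ne' (a.fixed c hc)
    have hsucc : a.prof (c + 1) ≤ a.entry c :=
      (a.prof_le_iff).2 fun d hd => entry_lt_of_len_le (Fin.lt_def.2 hd) hlen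
    exact ⟨by rw [a.prof_succ, max_eq_left (by omega)], hsucc⟩
  · rintro ⟨hs, hsucc⟩
    refine ⟨⟨s, lt_len_iff_prof_pos.2 (by omega)⟩, rfl, ?_⟩
    rw [a.entry_eq, if_pos (by simp only; omega)]
    simp only [hs, Nat.add_sub_cancel]

/-- The profile of `p` is a rectangle: it takes the value `m + 1` at the positions up to `s`, and
vanishes after that. These are the join-irreducible columns, and the least column. -/
def IsRect (p : PBWColumn n) (s m : ℕ) : Prop := ∀ r, p.prof r = if r ≤ s then m + 1 else 0

theorem exists_isRect (hsm : s ≤ m) (hm : m < n) (hs : s + 1 < n) :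
    ∃ p : PBWColumn n, p.IsRect s m := by
  obtain ⟨p, hp⟩ := exists_prof_eq (n := n) (f := fun r => if r ≤ s then m + 1 else 0)
    ⟨s + 1, by omega, hs, fun r t h => by simp only; split_ifs <;> omega,
      fun r => by simp only; split_ifs <;> omega,
      fun r hr => by simp only; rw [if_pos (by omega)]; omega, fun r hr => if_neg (by omega)⟩
  exact ⟨p, congrFun hp⟩

theorem exists_isRect_of_lt_prof (hsm : s ≤ m) (h : m < a.prof s) :
    ∃ p : PBWColumn n, p.IsRect s m :=
  exists_isRect hsm (h.trans_le (a.prof_le s))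
    ((Nat.succ_le_of_lt (lt_len_iff_prof_pos.2 (Nat.zero_lt_of_lt h))).trans_lt a.len_lt)

namespace IsRect

theorem le_iff (hp : p.IsRect s m) : p ≤ a ↔ m < a.prof s := by
  rw [le_iff_prof]
  refine ⟨fun h => ?_, fun h r => ?_⟩
  · simpa only [hp s, le_refl, if_true, Nat.add_one_le_iff] using h s
  · rw [hp r]
    split_ifs with hr
    · exact h.trans_le (a.prof_antitone hr)
    · exact Nat.zero_le _

theorem le_iff_le_and_le (hp : p.IsRect s m) (hq : q.IsRect s' m') :
    p ≤ q ↔ s ≤ s' ∧ m ≤ m' := by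
  rw [hp.le_iff, hq s]
  split_ifs with h <;> omega

theorem len_eq (hp : p.IsRect s m) : p.len = s + 1 := by
  refine eq_of_forall_lt_iff fun r => ?_
  rw [lt_len_iff_prof_pos, hp r]
  split_ifs <;> omega

theorem entry_eq_ite (hp : p.IsRect s m) (r : Fin p.len) :
    (p.entry r : ℕ) = if (r : ℕ) = s then m else r := by
  have hlen := hp.len_eq
  have hr := r.2
  rw [p.entry_eq, hp, hp, if_pos (show (r : ℕ) ≤ s by omega)]
  split_ifs <;> omega

theorem mem_orderPart_iff (hp : p.IsRect s m) (hm : 0 < m) : p ∈ orderPart n ↔ s = m := by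
  have hlen := hp.len_eq
  refine ⟨fun h => ?_, ?_⟩
  · have hlast := h.2 ⟨s, by omega⟩
    rw [hp.entry_eq_ite, if_pos rfl] at hlast
    exact hlast.symm
  · rintro rfl
    refine ⟨by omega, fun r => ?_⟩
    rw [hp.entry_eq_ite]
    split_ifs with hr
    · exact hr.symm
    · rfl

theorem supIrred (hp : p.IsRect s m) (hm : 0 < m) : SupIrred p := by
  refine SupPrime.supIrred ⟨fun hmin => ?_, fun b c hbc => ?_⟩
  · have hn : 0 + 1 < n := p.len_pos.trans_lt p.len_lt
    obtain ⟨q, hq⟩ := exists_isRect le_rfl (Nat.zero_lt_of_lt hn) hn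
    have hqp : q ≤ p := (hq.le_iff_le_and_le hp).2 ⟨Nat.zero_le _, Nat.zero_le _⟩
    exact hm.not_ge ((hp.le_iff_le_and_le hq).1 (hmin hqp)).2
  · rwa [hp.le_iff, prof_sup, lt_max_iff, ← hp.le_iff, ← hp.le_iff] at hbc

end IsRect

theorem exists_isRect_of_supIrred (hp : SupIrred p) :
    ∃ s m, s ≤ m ∧ 0 < m ∧ p.IsRect s m := by
  have hlow : ∀ r : Fin p.len, (r : ℕ) < p.prof r := fun r => r.2.trans_le (p.len_le_prof r.2)
  choose R hR using fun r : Fin p.len =>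
    exists_isRect_of_lt_prof (a := p) (Nat.le_sub_one_of_lt (hlow r))
      (Nat.sub_one_lt (Nat.ne_zero_of_lt (hlow r)))
  have : Nonempty (Fin p.len) := ⟨⟨0, p.len_pos⟩⟩
  have hsup : p ≤ Finset.univ.sup' Finset.univ_nonempty R := le_iff_prof.2 fun r => by
    rcases lt_or_ge r p.len with hr | hr
    · have hle := le_iff_prof.1 (Finset.le_sup' R (Finset.mem_univ ⟨r, hr⟩)) r
      rw [hR ⟨r, hr⟩ r, if_pos le_rfl] at hle
      exact le_tsub_add.trans hle
    · rw [p.prof_eq_zero hr]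
      exact Nat.zero_le _
  obtain ⟨r, hr⟩ : ∃ r, p ≤ R r := by
    refine Finset.sup'_induction (p := fun q => p ≤ q → ∃ r, p ≤ R r) Finset.univ_nonempty R
      (fun q hq q' hq' h => ?_) (fun r _ h => ⟨r, h⟩) hsup
    exact ((supPrime_iff_supIrred.2 hp).2 h).elim hq hq'
  have hRp : R r ≤ p := (hR r).le_iff.2 (Nat.sub_one_lt (Nat.ne_zero_of_lt (hlow r)))
  have hrect : p.IsRect r (p.prof r - 1) := by
    have := hR r
    rwa [hRp.antisymm hr] at this
  refine ⟨r, p.prof r - 1, Nat.le_sub_one_of_lt (hlow r), Nat.pos_of_ne_zero fun h0 => ?_, hrect⟩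
  refine hp.1 fun q _ => hrect.le_iff.2 ?_
  have hr0 : (r : ℕ) = 0 := by
    have := hlow r
    omega
  rw [h0, hr0]
  exact lt_len_iff_prof_pos.1 q.len_pos

namespace IsRect

theorem mem_irredIdeal_iff (hp : p.IsRect s m) (hm : 0 < m) :
    p ∈ irredIdeal a ↔ m < a.prof s := by
  rw [← hp.le_iff]
  exact and_iff_right (hp.supIrred hm)

theorem mem_interpSet_iff_lt_len (hp : p.IsRect m m) (hm : 0 < m) :
    p ∈ interpSet (orderPart n) (irredIdeal a) ↔ m < a.len := by
  have hmem : p ∈ orderPart n := (hp.mem_orderPart_iff hm).2 rfl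
  rw [interpSet, Set.mem_ofPred_eq, hp.mem_irredIdeal_iff hm, and_iff_left (Or.inl hmem)]
  exact ⟨fun h => lt_len_iff_prof_pos.2 (Nat.zero_lt_of_lt h),
    fun h => h.trans_le (a.len_le_prof h)⟩

theorem forall_mem_irredIdeal_not_lt_iff (hp : p.IsRect s m) (hsm : s < m) :
    (∀ q ∈ irredIdeal a, ¬ p < q) ↔ a.prof s ≤ m + 1 ∧ a.prof (s + 1) ≤ m := by
  have hm := Nat.zero_lt_of_lt hsm
  refine ⟨fun hmax => ⟨le_of_not_gt fun hs => ?_, le_of_not_gt fun hs => ?_⟩, ?_⟩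
  · obtain ⟨q, hq⟩ := exists_isRect_of_lt_prof (hsm.le.trans (Nat.le_succ m)) hs
    refine hmax q ((hq.mem_irredIdeal_iff (Nat.succ_pos m)).2 hs) (lt_of_le_not_ge
      ((hp.le_iff_le_and_le hq).2 ⟨le_rfl, Nat.le_succ m⟩) fun h => ?_)
    exact (Nat.lt_succ_self m).not_ge ((hq.le_iff_le_and_le hp).1 h).2
  · obtain ⟨q, hq⟩ := exists_isRect_of_lt_prof (Nat.succ_le_of_lt hsm) hs
    refine hmax q ((hq.mem_irredIdeal_iff hm).2 hs) (lt_of_le_not_ge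
      ((hp.le_iff_le_and_le hq).2 ⟨Nat.le_succ s, le_rfl⟩) fun h => ?_)
    exact (Nat.lt_succ_self s).not_ge ((hq.le_iff_le_and_le hp).1 h).1
  · rintro ⟨hs, hsucc⟩ q hqa hpq
    obtain ⟨s', m', -, -, hq⟩ := exists_isRect_of_supIrred hqa.1
    have hle := (hp.le_iff_le_and_le hq).1 hpq.le
    have hnot := mt (hq.le_iff_le_and_le hp).2 hpq.not_ge
    have hprof := hq.le_iff.1 hqa.2
    rcases hle.1.eq_or_lt with rfl | hlt
    · omega
    · have := a.prof_antitone (Nat.succ_le_of_lt hlt)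
      simp only [Nat.succ_eq_add_one] at this
      omega

theorem mem_interpSet_iff_exists_entry (hp : p.IsRect s m) (hsm : s < m) :
    p ∈ interpSet (orderPart n) (irredIdeal a) ↔
      ∃ c : Fin a.len, (c : ℕ) = s ∧ (a.entry c : ℕ) = m := by
  have hm := Nat.zero_lt_of_lt hsm
  have hmem : p ∉ orderPart n := fun h => hsm.ne ((hp.mem_orderPart_iff hm).1 h)
  rw [exists_entry_eq_iff hsm, interpSet, Set.mem_ofPred_eq, hp.mem_irredIdeal_iff hm,
    or_iff_right hmem, hp.forall_mem_irredIdeal_not_lt_iff hsm]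
  omega

end IsRect

theorem leadExp_apply_zero (a : PBWColumn n) (s : ℕ) : a.leadExp (s, 0) = a.len - s := by
  rw [leadExp, sum_rectExp_apply, ← card_filter_fin_le_val]
  simp only [Prod.mk_le_mk, Nat.zero_le, and_true]

open Classical in
theorem leadExp_add_leadExp_succ (a : PBWColumn n) (s m : ℕ) :
    a.leadExp (s, m) + a.leadExp (s + 1, m + 1) = a.leadExp (s + 1, m) + a.leadExp (s, m + 1) +
      if ∃ c : Fin a.len, (c : ℕ) = s ∧ (a.entry c : ℕ) = m then 1 else 0 := by
  have hcard : (Finset.univ.filter fun c : Fin a.len => ((c : ℕ), (a.entry c : ℕ)) = (s, m)).card =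
      if ∃ c : Fin a.len, (c : ℕ) = s ∧ (a.entry c : ℕ) = m then 1 else 0 := by
    split_ifs with h
    · obtain ⟨c, rfl, rfl⟩ := h
      refine Finset.card_eq_one.2 ⟨c, ?_⟩
      ext d
      simp only [Finset.mem_filter_univ, Finset.mem_singleton, Prod.mk.injEq]
      exact ⟨fun hd => Fin.ext hd.1, by rintro rfl; exact ⟨rfl, rfl⟩⟩
    · exact Finset.card_eq_zero.2 (Finset.filter_eq_empty_iff.2 fun d _ hd =>
        h ⟨d, Prod.mk.injEq .. ▸ hd⟩)
  rw [← hcard]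
  exact sum_rectExp_add_sum_rectExp _ s m

theorem isOdot_of_leadExp_add_eq (hgh : g ≤ h)
    (heq : g.leadExp + h.leadExp = a.leadExp + b.leadExp) : IsOdot (orderPart n) a b g := by
  classical
  rw [IsOdot, ← irredIdeal_sup, ← eq_sup_of_leadExp_add_eq hgh heq]
  have hE : ∀ s m, g.leadExp (s, m) + h.leadExp (s, m) = a.leadExp (s, m) + b.leadExp (s, m) :=
    fun s m => DFunLike.congr_fun heq (s, m)
  funext p
  simp only [Pi.add_apply, Set.indicator_apply, Pi.one_apply]
  by_cases hp : SupIrred p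
  · obtain ⟨s, m, hsm, hm, hrect⟩ := exists_isRect_of_supIrred hp
    rcases hsm.eq_or_lt with rfl | hlt
    · have hs := hE s 0
      have hsucc := hE (s + 1) 0
      simp only [leadExp_apply_zero] at hs hsucc
      simp only [hrect.mem_interpSet_iff_lt_len hm]
      split_ifs <;> omega
    · simp only [hrect.mem_interpSet_iff_exists_entry hlt]
      have ha := a.leadExp_add_leadExp_succ s m
      have hb := b.leadExp_add_leadExp_succ s m
      have hg := g.leadExp_add_leadExp_succ s m
      have hh := h.leadExp_add_leadExp_succ s m
      have := hE s m
      have := hE (s + 1) m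
      have := hE s (m + 1)
      have := hE (s + 1) (m + 1)
      omega
  · have hnot : ∀ c : PBWColumn n, p ∉ interpSet (orderPart n) (irredIdeal c) :=
      fun c hc => hp hc.1.1
    simp only [hnot, if_false]

end PBWColumn

/-! ### Straightening relations of the Plücker ideal -/

namespace PBWColumn

open MvPolynomial

variable {n : ℕ} {a b : PBWColumn n}

theorem hasQuadraticStraightening_plueckerIdeal (n : ℕ) :
    HasQuadraticStraightening (plueckerIdeal n) where
  disjoint := disjoint_plueckerIdeal_standardPolynomials n
  exists_quadForm a b _ _ := by
    obtain ⟨c, hc, hrel⟩ := exists_quadForm_sub_mem_plueckerIdeal a b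
    have hle : ∀ p ∈ c.support, p.1 ≤ p.2 := fun p hp => (hc p hp).1
    exact ⟨c, fun p hp => ⟨le_inf_iff.1 (le_inf_of_mem_support hle hrel hp),
      sup_le_iff.1 (sup_le_of_mem_support hle hrel hp)⟩, hrel⟩

theorem exists_quadForm_odot (a b : PBWColumn n) :
    ∃ c : PBWColumn n × PBWColumn n →₀ ℂ, X a * X b - quadForm c ∈ plueckerIdeal n ∧
      (∀ p ∈ c.support, p.1 ≤ a ⊓ b ∧ a ⊔ b ≤ p.2) ∧
      ∃ g, (g, a ⊔ b) ∈ c.support ∧ IsOdot (orderPart n) a b g ∧ c (g, a ⊔ b) = 1 ∧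
        ∀ p ∈ c.support, p.2 = a ⊔ b → p.1 = g := by
  obtain ⟨c, hc, hrel⟩ := exists_quadForm_sub_mem_plueckerIdeal a b
  have hle : ∀ p ∈ c.support, p.1 ≤ p.2 := fun p hp => (hc p hp).1
  obtain ⟨⟨g, h⟩, hp, hlead, hone⟩ := exists_leadExp_add_eq hle hrel
  obtain rfl : h = a ⊔ b := eq_sup_of_leadExp_add_eq (hle _ hp) hlead
  refine ⟨c, hrel, fun p hp => ⟨le_inf_of_mem_support hle hrel hp,
    sup_le_of_mem_support hle hrel hp⟩, g, hp, isOdot_of_leadExp_add_eq (hle _ hp) hlead, hone,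
    fun q hq hsup => ?_⟩
  have hcontent := (hc q hq).2.trans (hc _ hp).2.symm
  rw [hsup] at hcontent
  exact entries_injective (Finset.val_injective (add_right_cancel hcontent))

theorem exists_eq_sub_sum_odot (hab : ¬ a ≤ b) {e : PlueckerRing n}
    (he : IsStraighteningRelation (plueckerIdeal n) a b e) :
    ∃ (m : ℕ) (g h : Fin (m + 1) → PBWColumn n) (c : Fin (m + 1) → ℂ),
      (∀ i, g i < h i ∧ c i ≠ 0) ∧ Function.Injective (fun i => (g i, h i)) ∧
      e = X a * X b - ∑ i, C (c i) * (X (g i) * X (h i)) ∧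
      IsOdot (orderPart n) a b (g 0) ∧ h 0 = a ⊔ b ∧ c 0 = 1 ∧
      ∀ i, i ≠ 0 → g i ≤ a ⊓ b ∧ a ⊔ b < h i := by
  obtain ⟨c, hrel, hc, g, hg, hodot, hone, huniq⟩ := exists_quadForm_odot a b
  have hlt : a ⊓ b < a ⊔ b := inf_lt_sup.2 fun h => hab h.le
  have hlt' : ∀ p ∈ c.support, p.1 < p.2 := fun p hp =>
    (hc p hp).1.trans_lt (hlt.trans_le (hc p hp).2)
  have he_eq : e = X a * X b - quadForm c := by
    refine (hasQuadraticStraightening_plueckerIdeal n).relation_unique he ⟨hrel, ?_⟩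
    rw [sub_sub_cancel_left]
    exact (standardPolynomials _).neg_mem
      (quadForm_mem_standardPolynomials fun p hp => (hlt' p hp).le)
  obtain ⟨m, f, h0, hf, hsum⟩ := exists_quadForm_eq_sum_fin hg
  refine ⟨m, fun i => (f i).1, fun i => (f i).2, fun i => c (f i),
    fun i => ⟨hlt' _ (hf i), Finsupp.mem_support_iff.1 (hf i)⟩, f.injective, hsum ▸ he_eq,
    by simp only [h0, hodot], by simp only [h0], by simp only [h0, hone],
    fun i hi => ⟨(hc _ (hf i)).1, (hc _ (hf i)).2.lt_of_ne fun hsup => hi (f.injective ?_)⟩⟩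
  rw [h0]
  exact Prod.ext (huniq _ (hf i) hsup.symm) hsup.symm

end PBWColumn

theorem mainTheorem5 (n : ℕ) (hn : 2 ≤ n) :
    -- for incomparable `a`, `b` there is exactly one straightening relation `e(a, b)`
    (∀ a b : PBWColumn n, ¬ a ≤ b → ¬ b ≤ a →
      ∃! p, IsStraighteningRelation (plueckerIdeal n) a b p) ∧
    -- the relations `e(a, b)` form a minimal generating set of the Plücker ideal
    Minimal (fun S : Set (PlueckerRing n) => Ideal.span S = plueckerIdeal n)
      {p | ∃ a b : PBWColumn n, ¬ a ≤ b ∧ ¬ b ≤ a ∧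
        IsStraighteningRelation (plueckerIdeal n) a b p} ∧
    -- the shape of `e(a, b)`
    (∀ a b : PBWColumn n, ¬ a ≤ b → ¬ b ≤ a →
      ∀ e, IsStraighteningRelation (plueckerIdeal n) a b e →
      ∃ (m : ℕ) (g h : Fin (m + 1) → PBWColumn n) (c : Fin (m + 1) → ℂ),
        (∀ i, g i < h i ∧ c i ≠ 0) ∧
        Function.Injective (fun i => (g i, h i)) ∧
        e = MvPolynomial.X a * MvPolynomial.X b -
          ∑ i, MvPolynomial.C (c i) * (MvPolynomial.X (g i) * MvPolynomial.X (h i)) ∧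
        IsOdot (PBWColumn.orderPart n) a b (g 0) ∧ h 0 = a ⊔ b ∧ c 0 = 1 ∧
        ∀ i, i ≠ 0 → g i ≤ a ⊓ b ∧ a ⊔ b < h i) ∧
    -- the Plücker algebra is an algebra with straightening laws
    IsASL (fun b : PBWColumn n => Ideal.Quotient.mk (plueckerIdeal n) (MvPolynomial.X b)) := by
  have hI := PBWColumn.hasQuadraticStraightening_plueckerIdeal n
  exact ⟨fun a b => hI.existsUnique_relation, hI.minimal_straighteningRelations,
    fun a b hab _ e he => PBWColumn.exists_eq_sub_sum_odot hab he, hI.isASL⟩
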